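/- Let $N\ge 3$ be an integer. For $\nu\ge 0$ let $Y_\nu$ denote the Bessel function of the second kind of order $\nu$ and $y_\nu$ its first positive zero, let $H^{(1)}_\nu=J_\nu+iY_\nu$ be the Hankel function of the first kind, and let $\omega_N=\frac{2\pi^{N/2}}{N\,\Gamma(N/2)}$ be the volume of the unit ball of $\mathbb{R}^N$. For $x\in\mathbb{R}^N\setminus\{0\}$ put $$\Psi(x)=\operatorname{Re}\Bigl[\tfrac{i}{4}(2\pi|x|)^{\frac{2-N}{2}}H^{(1)}_{\frac{N-2}{2}}(|x|)\Bigr]=-\tfrac14(2\pi|x|)^{\frac{2-N}{2}}Y_{\frac{N-2}{2}}(|x|),\qquad \Lambda(x)=\frac{|x|^{2-N}}{N(N-2)\omega_N}$$ (the real fundamental solution of the Helmholtz equation $-\Delta u-u=\delta_0$ and the fundamental solution of Laplace's equation). Let $r>0$ satisfy $r<y_{(N-4)/2}$ if $N\ge 4$, and $r<\pi$ if $N=3$, and let $B_r$ be the open ball of radius $r$ centred at $0$. (i) There exist $\kappa_1,\kappa_2>0$ depending only on $r$ and $N$ such that for all $x\in B_r\setminus\{0\}$ $$\begin{cases}\kappa_1|x|^{4-N}\le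 \Psi(x)-\Lambda(x)\le\kappa_2|x|^{4-N}, & N\ge 5,\\ \kappa_1\bigl|\ln|x|\bigr|\le \Psi(x)-\Lambda(x)\le\kappa_2\bigl|\ln|x|\bigr|, & N=4,\\ -\kappa_2|x|\le \Psi(x)-\Lambda(x)\le-\kappa_1|x|, & N=3.\end{cases}$$ (ii) $\Psi-\Lambda$ is of class $C^\infty$ on $B_r\setminus\{0\}$, and for every integer $k\ge 1$ there exists $\kappa_3>0$ depending only on $k$, $r$ and $N$ such that for every multi-index $\alpha\in\mathbb{N}_0^N$ with $|\alpha|=k$ $$\bigl|\partial^\alpha(\Psi-\Lambda)(x)\bigr|\le\kappa_3|x|^{4-N-|\alpha|}\qquad\text{for all }x\in B_r\setminus\{0\}.$$ -/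

import Mathlib

open scoped ContDiff

noncomputable section

/-- The Bessel function of the first kind of real order `ν`, for arguments `t > 0`:
`J_ν(t) = ∑ₘ (-1)ᵐ / (m! Γ(m + ν + 1)) (t / 2) ^ (2 m + ν)`.
At a pole of `Γ` the coefficient `1 / Γ` is zero, as usual; this agrees with Mathlib's conventions
`Real.Gamma (-n) = 0` and `x / 0 = 0`. -/
def besselJ (ν t : ℝ) : ℝ :=
  ∑' m : ℕ, (-1 : ℝ) ^ m / ((m.factorial : ℝ) * Real.Gamma ((m : ℝ) + ν + 1)) *
    (t / 2) ^ (2 * (m : ℝ) + ν)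

/-- The digamma value `ψ(m + 1) = 1 + 1/2 + ⋯ + 1/m - γ`. -/
def digammaSucc (m : ℕ) : ℝ :=
  (harmonic m : ℝ) - Real.eulerMascheroniConstant

/-- The Bessel function of the second kind of integer order `n ≥ 0`, for arguments `t > 0`, through
its classical (Neumann) expansion
`Y_n(t) = (2/π) J_n(t) ln (t/2) - (1/π) ∑_{k<n} ((n-1-k)! / k!) (t/2)^(2k-n)
  - (1/π) ∑ₖ (-1)ᵏ (ψ(k+1) + ψ(n+k+1)) / (k! (n+k)!) (t/2)^(2k+n)`,
which is the limit of `(J_μ(t) cos μπ - J_{-μ}(t)) / sin μπ` as `μ → n`. -/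
def besselYNat (n : ℕ) (t : ℝ) : ℝ :=
  2 / Real.pi * besselJ n t * Real.log (t / 2)
    - 1 / Real.pi * ∑ k ∈ Finset.range n,
        ((n - 1 - k).factorial : ℝ) / (k.factorial : ℝ) * (t / 2) ^ (2 * (k : ℤ) - (n : ℤ))
    - 1 / Real.pi * ∑' k : ℕ,
        (-1 : ℝ) ^ k * (digammaSucc k + digammaSucc (n + k)) /
          ((k.factorial : ℝ) * ((n + k).factorial : ℝ)) * (t / 2) ^ (2 * k + n)

/-- The Bessel function of the second kind of order `ν ≥ 0`, for arguments `t > 0`: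
`Y_ν = (J_ν cos νπ - J_{-ν}) / sin νπ` if `ν` is not an integer, and the limit of this
expression, that is `besselYNat`, if `ν` is an integer. -/
def besselY (ν t : ℝ) : ℝ :=
  if ν = (⌊ν⌋₊ : ℝ) then besselYNat ⌊ν⌋₊ t
  else (besselJ ν t * Real.cos (ν * Real.pi) - besselJ (-ν) t) / Real.sin (ν * Real.pi)

/-- The first positive zero `y_ν` of `Y_ν`. -/
def besselYFirstZero (ν : ℝ) : ℝ :=
  sInf {t : ℝ | 0 < t ∧ besselY ν t = 0}

/-- The Hankel function of the first kind `H_ν⁽¹⁾ = J_ν + i Y_ν`. -/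
def hankelOne (ν t : ℝ) : ℂ :=
  (besselJ ν t : ℂ) + Complex.I * (besselY ν t : ℂ)

/-- The radial outgoing fundamental solution `Φ` of `-Δu - u = δ₀` in `ℝᴺ`:
`Φ(x) = (i/4) (2π|x|)^((2-N)/2) H⁽¹⁾_{(N-2)/2}(|x|)` for `x ≠ 0`. -/
def helmholtzOutgoing (N : ℕ) (x : EuclideanSpace ℝ (Fin N)) : ℂ :=
  Complex.I / 4 * (((2 * Real.pi * ‖x‖) ^ ((2 - (N : ℝ)) / 2) : ℝ) : ℂ) *
    hankelOne (((N : ℝ) - 2) / 2) ‖x‖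

/-- The real fundamental solution `Ψ = Re Φ` of the Helmholtz equation. -/
def helmholtzPsi (N : ℕ) (x : EuclideanSpace ℝ (Fin N)) : ℝ :=
  (helmholtzOutgoing N x).re

theorem helmholtzPsi_eq (N : ℕ) (x : EuclideanSpace ℝ (Fin N)) :
    helmholtzPsi N x = -(1 / 4) * (2 * Real.pi * ‖x‖) ^ ((2 - (N : ℝ)) / 2) *
      besselY (((N : ℝ) - 2) / 2) ‖x‖ := by
  unfold helmholtzPsi helmholtzOutgoing hankelOne
  generalize (2 * Real.pi * ‖x‖) ^ ((2 - (N : ℝ)) / 2) = c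
  simp

/-- The volume `ω_N = 2 π^(N/2) / (N Γ(N/2))` of the unit ball of `ℝᴺ`, `N ≥ 1`. -/
def unitBallVolume (N : ℕ) : ℝ :=
  2 * Real.pi ^ ((N : ℝ) / 2) / ((N : ℝ) * Real.Gamma ((N : ℝ) / 2))

/-- The fundamental solution of Laplace's equation in `ℝᴺ`, `N ≥ 3`:
`Λ(x) = |x|^(2-N) / (N (N-2) ω_N)` for `x ≠ 0`. -/
def laplaceLambda (N : ℕ) (x : EuclideanSpace ℝ (Fin N)) : ℝ :=
  1 / ((N : ℝ) * ((N : ℝ) - 2) * unitBallVolume N) * ‖x‖ ^ (2 - (N : ℤ))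

/-- The partial derivative `∂ᵢ f`. -/
def partialDeriv {N : ℕ} (i : Fin N) (f : EuclideanSpace ℝ (Fin N) → ℝ) :
    EuclideanSpace ℝ (Fin N) → ℝ :=
  fun x => lineDeriv ℝ f x (EuclideanSpace.single i 1)

/-- The partial derivative `∂^α f = ∂₁^{α₁} ⋯ ∂_N^{α_N} f` for a multi-index `α`. -/
def multiDeriv {N : ℕ} (α : Fin N → ℕ) (f : EuclideanSpace ℝ (Fin N) → ℝ) :
    EuclideanSpace ℝ (Fin N) → ℝ :=
  (List.finRange N).foldr (fun i g => (partialDeriv i)^[α i] g) f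

end

/-!
Write `ν = (N - 2) / 2`, `t = ‖x‖` and `u = (t / 2)²`. The Bessel function has an expansion
`Y_ν(t) = (t/2)^(-ν) g(u)` with `g(u) = P(u) + Q(u) log u`, where `P` and `Q` are entire power series
(`isNeumannExpansion_nat`, `isNeumannExpansion_half`; `Q = 0` for half-integer `ν`). The
value of `g` at the origin is `-Γ(ν)/π`, which is what `Λ` subtracts, so that
`Ψ - Λ = κ t^(2-N) (g(0) - g(u))` with `κ > 0` (`helmholtzPsi_sub_laplaceLambda`). Dividing out the
powers of `u` gives `Ψ - Λ = a(t²) t^(4-N) + b(t²) log (t/2)` with smooth `a` and `b`, and `b = 0` in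
odd dimension (`profile_eq`).

For the two-sided bounds, the sign of `g(0) - g(u)` is needed. The identity
`(t^ν Y_ν)' = t^ν Y_{ν-1}` reads `g_ν' = g_{ν-1}` in the variable `u` (`hasDerivAt_logSum`, checked
on coefficients), and `g_{ν-1}` is negative near the origin and has no
zero before the first zero of `Y_{ν-1}` (`logSum_lt_of_lt_besselYFirstZero`). In dimension three `g`
is a multiple of the cosine. The quotient of `Ψ - Λ` by the expected rate is thus positive on `(0, r]`
and extends continuously to `0` with a positive value, so compactness gives the constants. In dimension
four the rate `|log t|` must not vanish on `(0, r]`: this holds as the first zero of `Y₀` is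
at most `1`, because `Y₀(1) > 0` (`besselYFirstZero_zero_le_one`).

For the derivatives, a partial derivative of order `k` is bounded by the norm of the `k`-th Fréchet
derivative (`abs_multiDeriv_le`). The `k`-th derivatives of `‖x‖ ^ p` and, for `k ≥ 1`, of `log ‖x‖`
are homogeneous, hence bounded by `C ‖x‖ ^ (p - k)` and `C ‖x‖ ^ (-k)` by compactness of the unit
sphere; the smooth factors are handled with the Leibniz formula.
-/

noncomputable section

/-! ### Entire power series on the real line -/

/-- The sum of the power series `∑ aₖ uᵏ`. -/
def powerSum (a : ℕ → ℝ) (u : ℝ) : ℝ := ∑' k, a k * u ^ k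

/-- Coefficients of size at most `M Cᵏ / k!`. Unlike an infinite radius of convergence, this is a
bound that termwise differentiation preserves on sight. -/
def EntireCoeff (a : ℕ → ℝ) : Prop :=
  ∃ M C : ℝ, 0 ≤ M ∧ 0 ≤ C ∧ ∀ k, |a k| ≤ M * (C ^ k / (k.factorial : ℝ))

namespace EntireCoeff

theorem of_ratio {a : ℕ → ℝ} {C : ℝ} (hC : 0 ≤ C)
    (h : ∀ k : ℕ, (k + 1) * |a (k + 1)| ≤ C * |a k|) : EntireCoeff a := by
  refine ⟨|a 0|, C, abs_nonneg _, hC, fun k => ?_⟩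
  induction k with
  | zero => simp
  | succ k ih =>
    have hk : (0 : ℝ) < k + 1 := by positivity
    rw [← mul_le_mul_iff_right₀ hk]
    refine (h k).trans ((mul_le_mul_of_nonneg_left ih hC).trans (le_of_eq ?_))
    rw [Nat.factorial_succ]
    push_cast
    field_simp
    ring

theorem zero : EntireCoeff (fun _ => 0) := ⟨0, 0, le_rfl, le_rfl, by simp⟩

theorem summable {a : ℕ → ℝ} (ha : EntireCoeff a) (u : ℝ) :
    Summable fun k => a k * u ^ k := by
  obtain ⟨M, C, hM, hC, h⟩ := ha
  refine Summable.of_norm_bounded ((Real.summable_pow_div_factorial (C * |u|)).mul_left M) ?_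
  intro k
  rw [Real.norm_eq_abs, abs_mul, abs_pow]
  calc |a k| * |u| ^ k ≤ M * (C ^ k / (k.factorial : ℝ)) * |u| ^ k := by gcongr; exact h k
    _ = _ := by rw [mul_pow]; ring

theorem shift {a : ℕ → ℝ} (ha : EntireCoeff a) : EntireCoeff fun k => a (k + 1) := by
  obtain ⟨M, C, hM, hC, h⟩ := ha
  refine ⟨M * C, C, by positivity, hC, fun k => (h (k + 1)).trans ?_⟩
  rw [pow_succ, mul_assoc]
  gcongr
  rw [mul_comm C, div_mul_eq_mul_div]
  gcongr
  omega

theorem shift_iterate {a : ℕ → ℝ} (ha : EntireCoeff a) (n : ℕ) :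
    EntireCoeff fun k => a (k + n) := by
  induction n with
  | zero => exact ha
  | succ n ih => simpa only [Nat.add_assoc, Nat.add_comm 1 n] using ih.shift

theorem deriv {a : ℕ → ℝ} (ha : EntireCoeff a) :
    EntireCoeff fun k => ((k : ℝ) + 1) * a (k + 1) := by
  obtain ⟨M, C, hM, hC, h⟩ := ha
  refine ⟨M * C, C, by positivity, hC, fun k => ?_⟩
  have hk : (0 : ℝ) < k + 1 := by positivity
  rw [abs_mul, abs_of_pos hk]
  refine (mul_le_mul_of_nonneg_left (h (k + 1)) hk.le).trans (le_of_eq ?_)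
  rw [Nat.factorial_succ]
  push_cast
  field_simp
  ring

theorem of_shift {a : ℕ → ℝ} (ha : EntireCoeff fun k => a (k + 1)) : EntireCoeff a := by
  obtain ⟨M, C, hM, hC, h⟩ := ha
  refine ⟨M + |a 0|, 2 * (C + 1), by positivity, by positivity, fun k => ?_⟩
  rcases k with _ | k
  · simpa using hM
  have hpow : C ^ k * (k + 1) ≤ (2 * (C + 1)) ^ (k + 1) := by
    have h2 : ((k : ℝ) + 1) ≤ 2 ^ (k + 1) := by
      exact_mod_cast (Nat.lt_two_pow_self (n := k + 1)).le
    have h1 : C ^ k ≤ (C + 1) ^ (k + 1) :=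
      (pow_le_pow_left₀ hC (by linarith) k).trans
        (pow_le_pow_right₀ (by linarith) (Nat.le_succ k))
    calc C ^ k * (k + 1) ≤ (C + 1) ^ (k + 1) * 2 ^ (k + 1) := by gcongr
      _ = _ := by rw [mul_pow, mul_comm]
  calc |a (k + 1)| ≤ M * (C ^ k / (k.factorial : ℝ)) := h k
    _ = M * (C ^ k * (k + 1) / ((k + 1).factorial : ℝ)) := by
      rw [Nat.factorial_succ]
      push_cast
      field_simp
    _ ≤ (M + |a 0|) * ((2 * (C + 1)) ^ (k + 1) / ((k + 1).factorial : ℝ)) := by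
      gcongr
      exact le_add_of_nonneg_right (abs_nonneg _)

theorem of_shift_iterate {a : ℕ → ℝ} (n : ℕ) (ha : EntireCoeff fun k => a (k + n)) :
    EntireCoeff a := by
  induction n with
  | zero => exact ha
  | succ n ih =>
    refine ih (of_shift ?_)
    simpa only [Nat.add_assoc, Nat.add_comm 1 n] using ha

theorem hasDerivAt_powerSum {a : ℕ → ℝ} (ha : EntireCoeff a) (u : ℝ) :
    HasDerivAt (powerSum a) (powerSum (fun k => ((k : ℝ) + 1) * a (k + 1)) u) u := by
  obtain ⟨M, C, hM, hC, h⟩ := ha.deriv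
  set R : ℝ := |u| + 1
  have hR : 0 ≤ R := by positivity
  set b : ℕ → ℝ := fun k => M * ((C * R) ^ (k - 1) / ((k - 1).factorial : ℝ))
  have hb : Summable b := by
    rw [← summable_nat_add_iff 1]
    simpa [b] using (Real.summable_pow_div_factorial (C * R)).mul_left M
  have key := hasDerivAt_tsum_of_isPreconnected (𝕜 := ℝ) (F := ℝ) (u := b)
    (g := fun k v => a k * v ^ k) (g' := fun k v => a k * (k * v ^ (k - 1)))
    (t := Metric.ball 0 R) (y₀ := u) (y := u) hb Metric.isOpen_ball
    (convex_ball _ _).isPreconnected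
    (fun k v _ => (hasDerivAt_pow k v).const_mul (a k)) ?_
    (by simp [R]) (ha.summable u) (by simp [R])
  · refine key.congr_deriv ?_
    have hs : Summable fun k : ℕ => a k * (k * u ^ (k - 1)) := by
      rw [← summable_nat_add_iff 1]
      refine (ha.deriv.summable u).congr fun k => ?_
      simp only [Nat.add_sub_cancel]
      push_cast
      ring
    rw [hs.tsum_eq_zero_add, powerSum]
    simp only [Nat.cast_zero, zero_mul, mul_zero, zero_add, Nat.add_sub_cancel]
    refine tsum_congr fun k => ?_
    push_cast
    ring
  · intro k v hv
    rw [mem_ball_zero_iff, Real.norm_eq_abs] at hv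
    rcases k with _ | k
    · simp only [Nat.cast_zero, zero_mul, mul_zero, norm_zero, b]
      positivity
    · simp only [Nat.add_sub_cancel, b, Real.norm_eq_abs]
      calc |a (k + 1) * (((k + 1 : ℕ) : ℝ) * v ^ k)|
          = |((k : ℝ) + 1) * a (k + 1)| * |v| ^ k := by
            rw [← abs_pow, ← abs_mul]; push_cast; congr 1; ring
        _ ≤ M * (C ^ k / (k.factorial : ℝ)) * R ^ k := by
            gcongr
            exact h k
        _ = _ := by rw [mul_pow]; ring

theorem contDiff_powerSum {a : ℕ → ℝ} (ha : EntireCoeff a) : ContDiff ℝ ∞ (powerSum a) := by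
  rw [contDiff_infty]
  intro n
  induction n generalizing a with
  | zero =>
    exact contDiff_zero.2 (continuous_iff_continuousAt.2 fun u =>
      (ha.hasDerivAt_powerSum u).continuousAt)
  | succ n ih =>
    have : ((n + 1 : ℕ) : WithTop ℕ∞) = (n : WithTop ℕ∞) + 1 := by push_cast; rfl
    rw [this, contDiff_succ_iff_deriv]
    refine ⟨fun u => (ha.hasDerivAt_powerSum u).differentiableAt, by simp, ?_⟩
    rw [show _root_.deriv (powerSum a) = _ from
      funext fun u => (ha.hasDerivAt_powerSum u).deriv]
    exact ih ha.deriv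

theorem powerSum_eq_add {a : ℕ → ℝ} (ha : EntireCoeff a) (u : ℝ) :
    powerSum a u = a 0 + u * powerSum (fun k => a (k + 1)) u := by
  rw [powerSum, (ha.summable u).tsum_eq_zero_add, powerSum, ← tsum_mul_left]
  simp only [pow_zero, mul_one]
  congr 1
  exact tsum_congr fun k => by ring

end EntireCoeff

theorem powerSum_zero (a : ℕ → ℝ) : powerSum a 0 = a 0 := by
  rw [powerSum, tsum_eq_single 0 (fun k hk => by simp [hk])]
  simp

/-- A power series whose first `n` coefficients vanish is divisible by `uⁿ`. -/
theorem powerSum_eq_pow_mul {a : ℕ → ℝ} {n : ℕ} (ha : ∀ k < n, a k = 0) (u : ℝ)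
    (hs : EntireCoeff a) : powerSum a u = u ^ n * powerSum (fun k => a (k + n)) u := by
  have h := (hs.summable u).sum_add_tsum_nat_add n
  rw [powerSum, ← h, Finset.sum_eq_zero (fun k hk => by
    rw [ha k (Finset.mem_range.1 hk), zero_mul]), zero_add, powerSum, ← tsum_mul_left]
  exact tsum_congr fun k => by ring

/-! ### Expansions of the Bessel functions of the second kind -/

/-- The expansion `Y_ν(t) = (t/2)^(-ν) (P(u) + Q(u) log u)`, `u = (t/2)²`, where `P` and `Q` are the
entire functions with the coefficients `p` and `q`. -/
structure IsNeumannExpansion (ν : ℝ) (p q : ℕ → ℝ) : Prop where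
  entire_left : EntireCoeff p
  entire_right : EntireCoeff q
  besselY_eq : ∀ t : ℝ, 0 < t → besselY ν t = (t / 2) ^ (-ν) *
    (powerSum p ((t / 2) ^ 2) + powerSum q ((t / 2) ^ 2) * Real.log ((t / 2) ^ 2))

/-- The coefficients of the part of `t^n Y_n(t)` without logarithm: the finite principal part for
`k < n`, and the digamma series from `k = n` on. -/
def neumannCoeff (n k : ℕ) : ℝ :=
  if k < n then -(((n - 1 - k).factorial : ℝ) / (Real.pi * k.factorial))
  else -((-1) ^ (k - n) * (digammaSucc (k - n) + digammaSucc k) /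
    (Real.pi * ((k - n).factorial * k.factorial)))

/-- The coefficients of the factor of `log u` in `t^n Y_n(t)`. -/
def neumannLogCoeff (n k : ℕ) : ℝ :=
  if k < n then 0 else (-1) ^ (k - n) / (Real.pi * ((k - n).factorial * k.factorial))

theorem neumannLogCoeff_add (n k : ℕ) : neumannLogCoeff n (k + n) =
    (-1) ^ k / (Real.pi * (k.factorial * (k + n).factorial)) := by
  simp [neumannLogCoeff]

theorem neumannCoeff_add (n k : ℕ) : neumannCoeff n (k + n) =
    -((-1) ^ k * (digammaSucc k + digammaSucc (k + n)) /
      (Real.pi * (k.factorial * (k + n).factorial))) := by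
  simp [neumannCoeff]

theorem harmonic_mem_Icc (k : ℕ) : (harmonic k : ℝ) ∈ Set.Icc 0 (k : ℝ) := by
  rw [harmonic]
  push_cast
  refine ⟨by positivity, (Finset.sum_le_card_nsmul _ _ 1 fun i _ => ?_).trans (by simp)⟩
  exact inv_le_one_of_one_le₀ (by linarith [Nat.cast_nonneg (α := ℝ) i])

theorem abs_digammaSucc_le (k : ℕ) : |digammaSucc k| ≤ k + 1 := by
  obtain ⟨h0, h1⟩ := harmonic_mem_Icc k
  have h2 := Real.one_half_lt_eulerMascheroniConstant
  have h3 := Real.eulerMascheroniConstant_lt_two_thirds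
  rw [digammaSucc, abs_le]
  constructor <;> linarith

theorem entireCoeff_neumannLogCoeff (n : ℕ) : EntireCoeff (neumannLogCoeff n) := by
  refine .of_shift_iterate n ⟨1, 1, by norm_num, by norm_num, fun k => ?_⟩
  beta_reduce
  rw [neumannLogCoeff_add, abs_div, abs_pow, abs_neg, abs_one, one_pow, one_mul,
    abs_of_pos (by positivity)]
  gcongr
  have h1 : (1 : ℝ) ≤ Real.pi := by linarith [Real.pi_gt_three]
  have h2 : (1 : ℝ) ≤ (k + n).factorial := by exact_mod_cast Nat.factorial_pos _
  have h3 : (0 : ℝ) < k.factorial := by positivity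
  nlinarith [mul_le_mul h1 h2 (by norm_num) (by linarith)]

theorem entireCoeff_neumannCoeff (n : ℕ) : EntireCoeff (neumannCoeff n) := by
  refine .of_shift_iterate n ⟨4, 1, by norm_num, by norm_num, fun k => ?_⟩
  have h1 : (1 : ℝ) ≤ Real.pi := by linarith [Real.pi_gt_three]
  have h2 : (1 : ℝ) ≤ (k + n).factorial := by exact_mod_cast Nat.factorial_pos _
  have h3 : (0 : ℝ) < k.factorial := by positivity
  have h4 : ((k : ℝ) + n) ≤ (k + n).factorial := by exact_mod_cast Nat.self_le_factorial _
  have h5 : |digammaSucc k + digammaSucc (k + n)| ≤ 4 * (k + n).factorial := by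
    have h6 := abs_digammaSucc_le k
    have h7 := abs_digammaSucc_le (k + n)
    push_cast at h7
    refine (abs_add_le _ _).trans ?_
    linarith [Nat.cast_nonneg (α := ℝ) n]
  beta_reduce
  rw [neumannCoeff_add, abs_neg, abs_div, abs_mul, abs_pow, abs_neg, abs_one, one_pow, one_mul,
    abs_of_pos (a := Real.pi * _) (by positivity), div_le_iff₀ (by positivity)]
  refine h5.trans ?_
  have : 4 * (1 / (k.factorial : ℝ)) * (Real.pi * (k.factorial * (k + n).factorial))
      = 4 * (Real.pi * (k + n).factorial) := by field_simp
  rw [this]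
  nlinarith

theorem besselJ_natCast (n : ℕ) {t : ℝ} (ht : 0 < t) :
    besselJ n t = Real.pi * ((t / 2) ^ n)⁻¹ * powerSum (neumannLogCoeff n) ((t / 2) ^ 2) := by
  have ht2 : 0 < t / 2 := by positivity
  rw [powerSum_eq_pow_mul (n := n) (fun k hk => by simp [neumannLogCoeff, hk]) _
    (entireCoeff_neumannLogCoeff n), besselJ, powerSum, ← mul_assoc, ← tsum_mul_left]
  refine tsum_congr fun m => ?_
  rw [neumannLogCoeff_add, ← Nat.cast_add, Real.Gamma_nat_eq_factorial,
    show (2 * (m : ℝ) + n) = ((2 * m + n : ℕ) : ℝ) by push_cast; ring, Real.rpow_natCast]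
  have hpi := Real.pi_ne_zero
  generalize t / 2 = v at *
  field_simp
  ring

theorem isNeumannExpansion_nat (n : ℕ) :
    IsNeumannExpansion n (neumannCoeff n) (neumannLogCoeff n) where
  entire_left := entireCoeff_neumannCoeff n
  entire_right := entireCoeff_neumannLogCoeff n
  besselY_eq t ht := by
    have ht2 : 0 < t / 2 := by positivity
    have hpi := Real.pi_ne_zero
    have hvn : (t / 2) ^ n ≠ 0 := by positivity
    rw [besselY, Nat.floor_natCast, if_pos rfl, besselYNat, besselJ_natCast n ht,
      Real.rpow_neg ht2.le, Real.rpow_natCast, Real.log_pow,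
      show powerSum (neumannCoeff n) ((t / 2) ^ 2) =
        ∑' k, neumannCoeff n k * ((t / 2) ^ 2) ^ k from rfl,
      ← ((entireCoeff_neumannCoeff n).summable ((t / 2) ^ 2)).sum_add_tsum_nat_add n]
    have h1 : ∑ k ∈ Finset.range n, neumannCoeff n k * ((t / 2) ^ 2) ^ k =
        -(1 / Real.pi * (t / 2) ^ n * ∑ k ∈ Finset.range n,
        ((n - 1 - k).factorial : ℝ) / (k.factorial : ℝ) *
          (t / 2) ^ (2 * (k : ℤ) - (n : ℤ))) := by
      rw [Finset.mul_sum, ← Finset.sum_neg_distrib]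
      refine Finset.sum_congr rfl fun k hk => ?_
      rw [neumannCoeff, if_pos (Finset.mem_range.1 hk), zpow_sub₀ ht2.ne',
        show 2 * (k : ℤ) = ((2 * k : ℕ) : ℤ) by push_cast; ring, zpow_natCast, zpow_natCast,
        pow_mul]
      field_simp
    have h2 : ∑' k, neumannCoeff n (k + n) * ((t / 2) ^ 2) ^ (k + n) =
        -(1 / Real.pi * (t / 2) ^ n * ∑' k : ℕ,
        (-1 : ℝ) ^ k * (digammaSucc k + digammaSucc (n + k)) /
          ((k.factorial : ℝ) * ((n + k).factorial : ℝ)) * (t / 2) ^ (2 * k + n)) := by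
      rw [← tsum_mul_left, ← tsum_neg]
      refine tsum_congr fun k => ?_
      rw [neumannCoeff_add, add_comm n k, ← pow_mul]
      field_simp
      ring
    rw [h1, h2]
    push_cast
    field_simp
    ring

/-- The coefficients of `t^ν Y_ν(t)` for the half-integer order `ν = m + 1/2`, where
`Y_ν = (-1)^(m+1) J_{-ν}` and no logarithm occurs. -/
def halfCoeff (m k : ℕ) : ℝ :=
  -((-1) ^ (m + k) / (k.factorial * Real.Gamma ((k : ℝ) - m + 1 / 2)))

theorem one_half_le_abs_sub (k m : ℕ) : 1 / 2 ≤ |(k : ℝ) - m + 1 / 2| := by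
  rw [le_abs]
  rcases le_or_gt m k with h | h
  · left
    have : (m : ℝ) ≤ k := by exact_mod_cast h
    linarith
  · right
    have : (k : ℝ) + 1 ≤ m := by exact_mod_cast h
    linarith

theorem entireCoeff_halfCoeff (m : ℕ) : EntireCoeff (halfCoeff m) := by
  refine .of_ratio (C := 2) (by norm_num) fun k => ?_
  have h1 := one_half_le_abs_sub k m
  have h0 : (k : ℝ) - m + 1 / 2 ≠ 0 := by
    intro h; rw [h, abs_zero] at h1; norm_num at h1
  rw [halfCoeff, halfCoeff, Nat.cast_succ,
    show (k : ℝ) + 1 - m + 1 / 2 = (k - m + 1 / 2) + 1 by ring, Real.Gamma_add_one h0]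
  simp only [abs_neg, abs_div, abs_mul, abs_pow, abs_one, one_pow, Nat.factorial_succ,
    Nat.cast_mul, Nat.abs_cast]
  have hk : (0 : ℝ) < k + 1 := by positivity
  calc ((k : ℝ) + 1) * (1 / (((k + 1 : ℕ) : ℝ) * k.factorial *
        (|(k : ℝ) - m + 1 / 2| * |Real.Gamma (k - m + 1 / 2)|)))
      = |(k : ℝ) - m + 1 / 2|⁻¹ * (1 / (k.factorial * |Real.Gamma (k - m + 1 / 2)|)) := by
        push_cast
        rw [show ((k : ℝ) + 1) * k.factorial *
          (|(k : ℝ) - m + 1 / 2| * |Real.Gamma (k - m + 1 / 2)|) =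
          ((k : ℝ) + 1) * (|(k : ℝ) - m + 1 / 2| * (k.factorial * |Real.Gamma (k - m + 1 / 2)|))
          by ring, ← mul_div_assoc, mul_one, ← div_div, div_self hk.ne', ← div_div, one_div,
          div_eq_mul_one_div]
    _ ≤ 2 * (1 / (k.factorial * |Real.Gamma (k - m + 1 / 2)|)) := by
        gcongr
        exact inv_le_of_inv_le₀ (by norm_num) (by linarith)

theorem isNeumannExpansion_half (m : ℕ) :
    IsNeumannExpansion (m + 1 / 2) (halfCoeff m) fun _ => 0 where
  entire_left := entireCoeff_halfCoeff m
  entire_right := .zero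
  besselY_eq t ht := by
    have ht2 : 0 < t / 2 := by positivity
    have hcos : Real.cos (((m : ℝ) + 1 / 2) * Real.pi) = 0 := by
      rw [add_mul, Real.cos_add, one_div_mul_eq_div, Real.cos_pi_div_two, Real.sin_nat_mul_pi]
      simp
    have hsin : Real.sin (((m : ℝ) + 1 / 2) * Real.pi) = (-1) ^ m := by
      rw [add_mul, Real.sin_add, one_div_mul_eq_div, Real.cos_pi_div_two, Real.sin_pi_div_two,
        Real.cos_nat_mul_pi]
      simp
    have hfloor : ⌊(m : ℝ) + 1 / 2⌋₊ = m := by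
      rw [Nat.floor_eq_iff (by positivity)]
      constructor <;> linarith
    have hz : powerSum (fun _ => 0) ((t / 2) ^ 2) = 0 := by simp [powerSum]
    rw [besselY, hfloor, if_neg (by intro h; linarith), hcos, hsin, hz, mul_zero, zero_sub,
      zero_mul, add_zero, besselJ, powerSum, neg_div, ← tsum_div_const, ← tsum_neg, ← tsum_mul_left]
    refine tsum_congr fun k => ?_
    rw [show 2 * (k : ℝ) + -((m : ℝ) + 1 / 2) = -((m : ℝ) + 1 / 2) + ((2 * k : ℕ) : ℝ) by
      push_cast; ring, Real.rpow_add ht2, Real.rpow_natCast, halfCoeff, pow_mul,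
      show (k : ℝ) + -((m : ℝ) + 1 / 2) + 1 = k - m + 1 / 2 by ring, pow_add]
    have h1 : ((-1 : ℝ) ^ m)⁻¹ = (-1) ^ m := by
      rw [← inv_pow]; norm_num
    rw [div_eq_mul_inv _ ((-1 : ℝ) ^ m), h1]
    ring

/-! ### The ladder relation and signs -/

/-- The function `P(u) + Q(u) log u` for the power series `P`, `Q` with coefficients `p`, `q`. -/
def logSum (p q : ℕ → ℝ) (u : ℝ) : ℝ := powerSum p u + powerSum q u * Real.log u

/-- The coefficient form of `d/du (P + Q log u) = P₁ + Q₁ log u`, where `Q(0) = 0`. -/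
structure IsLadder (p q p₁ q₁ : ℕ → ℝ) : Prop where
  log_zero : q 0 = 0
  left : ∀ k : ℕ, ((k : ℝ) + 1) * p (k + 1) + q (k + 1) = p₁ k
  right : ∀ k : ℕ, ((k : ℝ) + 1) * q (k + 1) = q₁ k

/-- For the expansions of Bessel functions this is `d/dt (t^ν Y_ν) = t^ν Y_{ν-1}`. -/
theorem hasDerivAt_logSum {p q p₁ q₁ : ℕ → ℝ} (hp : EntireCoeff p) (hq : EntireCoeff q)
    (h : IsLadder p q p₁ q₁) {u : ℝ} (hu : 0 < u) :
    HasDerivAt (logSum p q) (logSum p₁ q₁ u) u := by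
  refine ((hp.hasDerivAt_powerSum u).add ((hq.hasDerivAt_powerSum u).mul
    (Real.hasDerivAt_log hu.ne'))).congr_deriv ?_
  have h1 : powerSum (fun k => ((k : ℝ) + 1) * q (k + 1)) u = powerSum q₁ u := by
    congr 1; exact funext h.right
  have h2 : powerSum p₁ u = powerSum (fun k => ((k : ℝ) + 1) * p (k + 1)) u +
      powerSum (fun k => q (k + 1)) u := by
    simp only [powerSum]
    rw [← (hp.deriv.summable u).tsum_add (hq.shift.summable u)]
    exact tsum_congr fun k => by rw [← h.left, add_mul]
  rw [hq.powerSum_eq_add u, h.log_zero, zero_add, h1, logSum, h2]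
  field_simp
  ring

theorem isLadder_neumannCoeff (n : ℕ) :
    IsLadder (neumannCoeff (n + 1)) (neumannLogCoeff (n + 1))
      (neumannCoeff n) (neumannLogCoeff n) where
  log_zero := by simp [neumannLogCoeff]
  left k := by
    have hpi := Real.pi_ne_zero
    rcases lt_or_ge k n with h | h
    · rw [neumannCoeff, neumannCoeff, neumannLogCoeff, if_pos h, if_pos (by omega),
        if_pos (by omega), show n + 1 - 1 - (k + 1) = n - 1 - k by omega, Nat.factorial_succ]
      push_cast
      field_simp
      ring
    · obtain ⟨j, rfl⟩ := Nat.exists_eq_add_of_le' h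
      rw [neumannCoeff_add, show j + n + 1 = j + (n + 1) by ring, neumannCoeff_add,
        neumannLogCoeff_add, ← add_assoc]
      have hd : digammaSucc (j + n + 1) = digammaSucc (j + n) + 1 / ((j : ℝ) + n + 1) := by
        rw [digammaSucc, digammaSucc, harmonic_succ]
        push_cast
        ring
      have h0 : (j : ℝ) + n + 1 ≠ 0 := by positivity
      rw [hd, Nat.factorial_succ]
      push_cast
      field_simp
      ring
  right k := by
    have hpi := Real.pi_ne_zero
    rcases lt_or_ge k n with h | h
    · rw [neumannLogCoeff, neumannLogCoeff, if_pos h, if_pos (by omega), mul_zero]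
    · obtain ⟨j, rfl⟩ := Nat.exists_eq_add_of_le' h
      have h0 : (j : ℝ) + n + 1 ≠ 0 := by positivity
      rw [neumannLogCoeff_add, show j + n + 1 = j + (n + 1) by ring, neumannLogCoeff_add,
        ← add_assoc, Nat.factorial_succ]
      push_cast
      field_simp

theorem isLadder_halfCoeff (m : ℕ) :
    IsLadder (halfCoeff (m + 1)) (fun _ => 0) (halfCoeff m) fun _ => 0 where
  log_zero := rfl
  left k := by
    rw [halfCoeff, halfCoeff, Nat.factorial_succ]
    have h0 : (k : ℝ) + 1 ≠ 0 := by positivity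
    push_cast
    rw [show (k : ℝ) + 1 - (m + 1) + 1 / 2 = k - m + 1 / 2 by ring, add_zero, mul_assoc,
      ← div_div, show m + 1 + (k + 1) = m + k + 2 by ring, pow_add, mul_neg,
      div_div, ← mul_div_assoc, mul_div_mul_left _ _ h0]
    norm_num
  right k := by simp

theorem neumannCoeff_zero {n : ℕ} (hn : 0 < n) :
    neumannCoeff n 0 = -(Real.Gamma n / Real.pi) := by
  obtain ⟨n, rfl⟩ := Nat.exists_eq_add_of_le' hn
  rw [neumannCoeff, if_pos (by omega), Nat.cast_add, Nat.cast_one, Real.Gamma_nat_eq_factorial]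
  simp

/-- The value `-Γ(ν)/π` at `ν = m + 1/2`, by the reflection formula for `Γ`. -/
theorem halfCoeff_zero (m : ℕ) :
    halfCoeff m 0 = -(Real.Gamma ((m : ℝ) + 1 / 2) / Real.pi) := by
  have h := Real.Gamma_mul_Gamma_one_sub ((m : ℝ) + 1 / 2)
  have hsin : Real.sin (Real.pi * ((m : ℝ) + 1 / 2)) = (-1) ^ m := by
    rw [mul_comm, add_mul, Real.sin_add, one_div_mul_eq_div, Real.cos_pi_div_two,
      Real.sin_pi_div_two, Real.cos_nat_mul_pi]
    simp
  rw [hsin, show 1 - ((m : ℝ) + 1 / 2) = (0 : ℕ) - m + 1 / 2 by push_cast; ring] at h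
  have hs : ((-1 : ℝ) ^ m) ≠ 0 := by positivity
  have hpi := Real.pi_ne_zero
  have hG : Real.Gamma ((0 : ℕ) - (m : ℝ) + 1 / 2) ≠ 0 := by
    intro h0
    rw [h0, mul_zero] at h
    exact div_ne_zero hpi hs h.symm
  have hs2 : ((-1 : ℝ) ^ m) * (-1) ^ m = 1 := by rw [← mul_pow]; norm_num
  rw [halfCoeff, add_zero, Nat.factorial_zero, Nat.cast_one, one_mul]
  congr 1
  rw [div_eq_div_iff hG hpi, h, eq_div_iff hs, mul_right_comm, hs2, one_mul]

theorem continuousOn_logSum {p q : ℕ → ℝ} (hp : EntireCoeff p) (hq : EntireCoeff q) :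
    ContinuousOn (logSum p q) (Set.Ioi 0) :=
  hp.contDiff_powerSum.continuous.continuousOn.add
    (hq.contDiff_powerSum.continuous.continuousOn.mul
      (Real.continuousOn_log.mono fun _ hx => (ne_of_gt hx)))

theorem tendsto_powerSum_zero {p : ℕ → ℝ} (hp : EntireCoeff p) :
    Filter.Tendsto (powerSum p) (nhdsWithin 0 (Set.Ioi 0)) (nhds (p 0)) := by
  have h := hp.contDiff_powerSum.continuous.tendsto 0
  rw [powerSum_zero] at h
  exact h.mono_left nhdsWithin_le_nhds

theorem tendsto_logSum {p q : ℕ → ℝ} (hp : EntireCoeff p) (hq : EntireCoeff q) (h0 : q 0 = 0) :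
    Filter.Tendsto (logSum p q) (nhdsWithin 0 (Set.Ioi 0)) (nhds (p 0)) := by
  have h1 : Filter.Tendsto (fun u : ℝ => u * Real.log u) (nhdsWithin 0 (Set.Ioi 0)) (nhds 0) := by
    have := Real.continuous_mul_log.tendsto 0
    simp only [Real.log_zero, mul_zero] at this
    exact this.mono_left nhdsWithin_le_nhds
  have h2 := (tendsto_powerSum_zero hp).add ((tendsto_powerSum_zero hq.shift).mul h1)
  rw [mul_zero, add_zero] at h2
  refine h2.congr fun u => ?_
  rw [logSum, hq.powerSum_eq_add u, h0]
  ring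

theorem eventually_logSum_neg {p q : ℕ → ℝ} (hp : EntireCoeff p) (hq : EntireCoeff q)
    (h : 0 < q 0 ∨ q 0 = 0 ∧ p 0 < 0) :
    ∀ᶠ u in nhdsWithin 0 (Set.Ioi 0), logSum p q u < 0 := by
  rcases h with h | ⟨h0, h⟩
  · have h1 := (tendsto_powerSum_zero hp).add_atBot
      ((tendsto_powerSum_zero hq).pos_mul_atBot h Real.tendsto_log_nhdsGT_zero)
    exact h1.eventually_lt_atBot 0
  · exact (tendsto_logSum hp hq h0).eventually_lt_const h

theorem tendsto_half_sq :
    Filter.Tendsto (fun t : ℝ => (t / 2) ^ 2) (nhdsWithin 0 (Set.Ioi 0))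
      (nhdsWithin 0 (Set.Ioi 0)) := by
  refine tendsto_nhdsWithin_of_tendsto_nhds_of_eventually_within _ ?_ ?_
  · have : Continuous fun t : ℝ => (t / 2) ^ 2 := by fun_prop
    have h := this.tendsto 0
    norm_num at h
    simpa using h.mono_left (nhdsWithin_le_nhds (s := Set.Ioi 0))
  · filter_upwards [self_mem_nhdsWithin] with t ht
    have ht : 0 < t := ht
    exact Set.mem_Ioi.2 (by positivity)

/-- A change of sign of the expansion on `(0, t]` forces a zero of `Y_ν` there. -/
theorem exists_besselY_zero {ν : ℝ} {p q : ℕ → ℝ} (h : IsNeumannExpansion ν p q)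
    (hneg : ∀ᶠ u in nhdsWithin 0 (Set.Ioi 0), logSum p q u < 0) {t : ℝ} (ht : 0 < t)
    (hpos : 0 ≤ logSum p q ((t / 2) ^ 2)) : ∃ s, 0 < s ∧ s ≤ t ∧ besselY ν s = 0 := by
  obtain ⟨s, hs, hs0, hst⟩ := ((tendsto_half_sq.eventually hneg).and
    (Ioo_mem_nhdsGT ht)).exists
  have hc : ContinuousOn (fun t : ℝ => logSum p q ((t / 2) ^ 2)) (Set.Icc s t) := by
    refine (continuousOn_logSum h.entire_left h.entire_right).comp (by fun_prop) fun v hv => ?_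
    have : 0 < v := hs0.trans_le hv.1
    exact Set.mem_Ioi.2 (by positivity)
  obtain ⟨v, hv, hv0⟩ := intermediate_value_Icc hst.le hc ⟨hs.le, hpos⟩
  have hvp : 0 < v := hs0.trans_le hv.1
  refine ⟨v, hvp, hv.2, ?_⟩
  rw [h.besselY_eq v hvp]
  exact mul_eq_zero_of_right _ hv0

theorem besselYFirstZero_le {ν s : ℝ} (hs : 0 < s) (h : besselY ν s = 0) :
    besselYFirstZero ν ≤ s :=
  csInf_le ⟨0, fun _ hx => hx.1.le⟩ ⟨hs, h⟩

theorem logSum_neg_of_lt_besselYFirstZero {ν : ℝ} {p q : ℕ → ℝ} (h : IsNeumannExpansion ν p q)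
    (hneg : ∀ᶠ u in nhdsWithin 0 (Set.Ioi 0), logSum p q u < 0) {t : ℝ} (ht : 0 < t)
    (hty : t < besselYFirstZero ν) : logSum p q ((t / 2) ^ 2) < 0 := by
  by_contra! hpos
  obtain ⟨s, hs, hst, h0⟩ := exists_besselY_zero h hneg ht hpos
  linarith [besselYFirstZero_le hs h0]

/-- As long as the derivative is negative, the expansion stays below its limit at the origin. -/
theorem logSum_lt_of_isLadder {p q p₁ q₁ : ℕ → ℝ} (hp : EntireCoeff p) (hq : EntireCoeff q)
    (h : IsLadder p q p₁ q₁) {u : ℝ} (hu : 0 < u)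
    (hneg : ∀ v, 0 < v → v ≤ u → logSum p₁ q₁ v < 0) : logSum p q u < p 0 := by
  have hd : ∀ v, 0 < v → HasDerivAt (logSum p q) (logSum p₁ q₁ v) v :=
    fun v hv => hasDerivAt_logSum hp hq h hv
  have hanti : StrictAntiOn (logSum p q) (Set.Ioc 0 u) := by
    refine strictAntiOn_of_deriv_neg (convex_Ioc 0 u)
      (fun v hv => (hd v hv.1).continuousAt.continuousWithinAt) fun v hv => ?_
    rw [interior_Ioc] at hv
    rw [(hd v hv.1).deriv]
    exact hneg v hv.1 hv.2.le
  have hu2 : 0 < u / 2 := by positivity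
  have h1 : logSum p q u < logSum p q (u / 2) :=
    hanti ⟨hu2, by linarith⟩ ⟨hu, le_rfl⟩ (by linarith)
  refine h1.trans_le (ge_of_tendsto (tendsto_logSum hp hq h.log_zero) ?_)
  filter_upwards [Ioo_mem_nhdsGT hu2] with v hv
  exact (hanti ⟨hv.1, by linarith [hv.2]⟩ ⟨hu2, by linarith⟩ hv.2).le

/-- Below the first zero of `Y_ν`, the expansion one order higher stays below its limit at the
origin: its derivative is that of order `ν`, which is negative near the origin and has no zero. -/
theorem logSum_lt_of_lt_besselYFirstZero {ν : ℝ} {p q p₁ q₁ : ℕ → ℝ} (hp : EntireCoeff p)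
    (hq : EntireCoeff q) (hlad : IsLadder p q p₁ q₁) (h : IsNeumannExpansion ν p₁ q₁)
    (hneg : 0 < q₁ 0 ∨ q₁ 0 = 0 ∧ p₁ 0 < 0) {t : ℝ} (ht : 0 < t)
    (hty : t < besselYFirstZero ν) : logSum p q ((t / 2) ^ 2) < p 0 := by
  refine logSum_lt_of_isLadder hp hq hlad (by positivity) fun v hv hvt => ?_
  have hsv : (2 * √v / 2) ^ 2 = v := by
    rw [mul_div_cancel_left₀ _ two_ne_zero, Real.sq_sqrt hv.le]
  rw [← hsv]
  refine logSum_neg_of_lt_besselYFirstZero h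
    (eventually_logSum_neg h.entire_left h.entire_right hneg) (by positivity) ?_
  have : √v ≤ t / 2 := Real.sqrt_le_iff.2 ⟨by positivity, hvt⟩
  linarith

/-- `Y₀(1) > 0`, as `u = 1/4` for `t = 1`: the first two terms of the expansion dominate
the rest. -/
theorem logSum_neumann_zero_pos : 0 < logSum (neumannCoeff 0) (neumannLogCoeff 0) (1 / 4) := by
  have hpi := Real.pi_pos
  set γ := Real.eulerMascheroniConstant with hγ
  have hlog : Real.log (1 / 4) = -2 * Real.log 2 := by
    rw [one_div, Real.log_inv, show (4 : ℝ) = 2 ^ 2 by norm_num, Real.log_pow]; push_cast; ring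
  set f : ℕ → ℝ := fun k => (-1) ^ k * (γ - Real.log 2 - harmonic k) /
    ((k.factorial : ℝ) ^ 2 * 4 ^ k) with hf
  have hterm : ∀ k, neumannCoeff 0 k * (1 / 4) ^ k + neumannLogCoeff 0 k * (1 / 4) ^ k *
      Real.log (1 / 4) = 2 / Real.pi * f k := by
    intro k
    have h1 := neumannCoeff_add 0 k
    have h2 := neumannLogCoeff_add 0 k
    rw [add_zero] at h1 h2
    rw [h1, h2, hlog, hf, digammaSucc]
    simp only [one_div, inv_pow]
    field_simp
    ring
  have s1 := (entireCoeff_neumannCoeff 0).summable (1 / 4)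
  have s2 := ((entireCoeff_neumannLogCoeff 0).summable (1 / 4)).mul_right (Real.log (1 / 4))
  have hs : Summable f := by
    have := (s1.add s2).mul_left (Real.pi / 2)
    refine this.congr fun k => ?_
    rw [hterm]
    field_simp
  have hsum : logSum (neumannCoeff 0) (neumannLogCoeff 0) (1 / 4) = 2 / Real.pi * ∑' k, f k := by
    rw [logSum, powerSum, powerSum, ← tsum_mul_right, ← s1.tsum_add s2, ← tsum_mul_left]
    exact tsum_congr hterm
  rw [hsum]
  refine mul_pos (by positivity) ?_
  have hγ1 : 1 / 2 < γ := Real.one_half_lt_eulerMascheroniConstant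
  have hγ2 : γ < 2 / 3 := Real.eulerMascheroniConstant_lt_two_thirds
  have hl1 := Real.log_two_lt_d9
  have hl2 := Real.log_two_gt_d9
  -- For `k ≥ 2` the terms are at most `(k + 1) / (k!² 4ᵏ)`, with ratio at most `1/16`.
  have hg : HasSum (fun k : ℕ => 3 / 64 * (1 / 16 : ℝ) ^ k) (3 / 64 * (1 - 1 / 16)⁻¹) :=
    (hasSum_geometric_of_lt_one (by norm_num) (by norm_num)).mul_left _
  have htail : |∑' k, f (k + 2)| ≤ 3 / 64 * (1 - 1 / 16)⁻¹ := by
    rw [← Real.norm_eq_abs]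
    refine tsum_of_norm_bounded hg fun k => ?_
    obtain ⟨h0, h1⟩ := harmonic_mem_Icc (k + 2)
    push_cast at h1
    have h2 : |γ - Real.log 2 - harmonic (k + 2)| ≤ (k : ℝ) + 3 := by
      rw [abs_le]; constructor <;> linarith
    have h3 : ((k : ℝ) + 3) * 4 * 4 ^ k ≤ 3 * ((k + 2).factorial : ℝ) ^ 2 := by
      clear * -
      induction k with
      | zero => norm_num [Nat.factorial]
      | succ k ih =>
        rw [show k + 1 + 2 = (k + 2) + 1 by ring, Nat.factorial_succ]
        push_cast
        have hk : (0 : ℝ) ≤ k := Nat.cast_nonneg k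
        have h4 : 4 * ((k : ℝ) + 4) ≤ ((k : ℝ) + 2 + 1) ^ 2 * (k + 3) := by
          nlinarith [mul_nonneg hk hk, mul_nonneg hk (mul_nonneg hk hk)]
        calc ((k : ℝ) + 1 + 3) * 4 * 4 ^ (k + 1)
            = (4 * ((k : ℝ) + 4)) * (4 * 4 ^ k) := by ring
          _ ≤ (((k : ℝ) + 2 + 1) ^ 2 * (k + 3)) * (4 * 4 ^ k) := by
            gcongr
          _ = ((k : ℝ) + 2 + 1) ^ 2 * (((k : ℝ) + 3) * 4 * 4 ^ k) := by ring
          _ ≤ ((k : ℝ) + 2 + 1) ^ 2 * (3 * ((k + 2).factorial : ℝ) ^ 2) := by gcongr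
          _ = _ := by ring
    simp only [hf, Real.norm_eq_abs, abs_div, abs_mul, abs_pow, abs_neg, abs_one, one_pow, one_mul,
      Nat.abs_cast]
    rw [div_le_iff₀ (by positivity)]
    refine h2.trans ?_
    rw [abs_of_pos (by norm_num : (0 : ℝ) < 4)]
    have h5 : (16 : ℝ) ^ k = 4 ^ k * 4 ^ k := by rw [← mul_pow]; norm_num
    have h6 : 3 / 64 * (1 / 16 : ℝ) ^ k * (((k + 2).factorial : ℝ) ^ 2 * 4 ^ (k + 2)) =
        3 * ((k + 2).factorial : ℝ) ^ 2 / (4 * 4 ^ k) := by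
      rw [one_div, inv_pow, h5]
      field_simp
      ring
    rw [h6, le_div_iff₀ (by positivity)]
    linarith
  rw [← hs.sum_add_tsum_nat_add 2, Finset.sum_range_succ, Finset.sum_range_one]
  have h0 : f 0 = γ - Real.log 2 := by simp [hf]
  have h1 : f 1 = (1 - (γ - Real.log 2)) / 4 := by
    simp [hf]
  rw [h0, h1]
  have := (abs_le.1 htail).1
  norm_num at this ⊢
  linarith

/-- Hence in dimension four the ball lies inside the unit ball, where `log ‖x‖` has no zero. -/
theorem besselYFirstZero_zero_le_one : besselYFirstZero 0 ≤ 1 := by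
  have h := isNeumannExpansion_nat 0
  rw [Nat.cast_zero] at h
  have hq : 0 < neumannLogCoeff 0 0 := by simp [neumannLogCoeff, Real.pi_pos]
  obtain ⟨s, hs, hs1, h0⟩ := exists_besselY_zero h
    (eventually_logSum_neg h.entire_left h.entire_right (.inl hq)) one_pos
    (by norm_num; exact logSum_neumann_zero_pos.le.trans_eq (by norm_num))
  exact (besselYFirstZero_le hs h0).trans hs1

/-! ### Partial derivatives and iterated Fréchet derivatives -/

theorem partialDeriv_bound {N : ℕ} {U : Set (EuclideanSpace ℝ (Fin N))} (hU : IsOpen U)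
    {f : EuclideanSpace ℝ (Fin N) → ℝ} (hf : ContDiffOn ℝ ∞ f U) (i : Fin N) :
    ContDiffOn ℝ ∞ (partialDeriv i f) U ∧ ∀ l, ∀ x ∈ U,
      ‖iteratedFDeriv ℝ l (partialDeriv i f) x‖ ≤ ‖iteratedFDeriv ℝ (l + 1) f x‖ := by
  have heq : Set.EqOn (partialDeriv i f)
      (fun x => fderiv ℝ f x (EuclideanSpace.single i 1)) U := fun x hx =>
    (((hf x hx).contDiffAt (hU.mem_nhds hx)).differentiableAt (by simp)).lineDeriv_eq_fderiv
  have hd : ContDiffOn ℝ ∞ (fderiv ℝ f) U := hf.fderiv_of_isOpen hU (by simp)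
  refine ⟨(hd.clm_apply contDiffOn_const).congr heq, fun l x hx => ?_⟩
  rw [((heq.eventuallyEq_of_mem (hU.mem_nhds hx)).iteratedFDeriv (𝕜 := ℝ) l).eq_of_nhds,
    ← norm_iteratedFDeriv_fderiv]
  refine (norm_iteratedFDeriv_clm_apply_const ((hd x hx).contDiffAt (hU.mem_nhds hx))
    (by exact_mod_cast le_top)).trans ?_
  simp

theorem iterate_partialDeriv_bound {N : ℕ} {U : Set (EuclideanSpace ℝ (Fin N))} (hU : IsOpen U)
    {f : EuclideanSpace ℝ (Fin N) → ℝ} (hf : ContDiffOn ℝ ∞ f U) (i : Fin N) (j : ℕ) :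
    ContDiffOn ℝ ∞ ((partialDeriv i)^[j] f) U ∧ ∀ l, ∀ x ∈ U,
      ‖iteratedFDeriv ℝ l ((partialDeriv i)^[j] f) x‖ ≤ ‖iteratedFDeriv ℝ (l + j) f x‖ := by
  induction j with
  | zero => exact ⟨hf, fun l x _ => le_rfl⟩
  | succ j ih =>
    rw [Function.iterate_succ_apply']
    have h := partialDeriv_bound hU ih.1 i
    refine ⟨h.1, fun l x hx => (h.2 l x hx).trans ((ih.2 (l + 1) x hx).trans_eq ?_)⟩
    rw [show l + 1 + j = l + (j + 1) by ring]

/-- A partial derivative of order `k` is an entry of the `k`-th Fréchet derivative at unit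
vectors. -/
theorem abs_multiDeriv_le {N : ℕ} {U : Set (EuclideanSpace ℝ (Fin N))} (hU : IsOpen U)
    {f : EuclideanSpace ℝ (Fin N) → ℝ} (hf : ContDiffOn ℝ ∞ f U) (α : Fin N → ℕ)
    {x : EuclideanSpace ℝ (Fin N)} (hx : x ∈ U) :
    |multiDeriv α f x| ≤ ‖iteratedFDeriv ℝ (∑ i, α i) f x‖ := by
  have key : ∀ L : List (Fin N),
      ContDiffOn ℝ ∞ (L.foldr (fun i g => (partialDeriv i)^[α i] g) f) U ∧ ∀ l, ∀ x ∈ U,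
        ‖iteratedFDeriv ℝ l (L.foldr (fun i g => (partialDeriv i)^[α i] g) f) x‖ ≤
          ‖iteratedFDeriv ℝ (l + (L.map α).sum) f x‖ := by
    intro L
    induction L with
    | nil => exact ⟨hf, fun l x _ => le_rfl⟩
    | cons i L ih =>
      have h := iterate_partialDeriv_bound hU ih.1 i (α i)
      refine ⟨h.1, fun l x hx => (h.2 l x hx).trans ((ih.2 (l + α i) x hx).trans_eq ?_)⟩
      rw [List.map_cons, List.sum_cons, add_assoc]
  have h := (key (List.finRange N)).2 0 x hx
  rw [norm_iteratedFDeriv_zero, zero_add, Real.norm_eq_abs] at h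
  rwa [show ∑ i, α i = ((List.finRange N).map α).sum by
    rw [← List.sum_ofFn, List.ofFn_eq_map]]

/-! ### Derivatives of homogeneous functions -/

section Homogeneous

variable {E : Type*} [NormedAddCommGroup E] [InnerProductSpace ℝ E]

theorem contDiffOn_norm_zpow (p : ℤ) : ContDiffOn ℝ ∞ (fun x : E => ‖x‖ ^ p) {0}ᶜ := by
  intro x hx
  have hx0 : x ≠ 0 := hx
  have h1 : ContDiffAt ℝ ∞ (fun x : E => ‖x‖) x := contDiffAt_norm ℝ hx0
  refine ContDiffAt.contDiffWithinAt ?_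
  rcases p with p | p
  · simpa using h1.pow p
  · simp only [zpow_negSucc]
    exact (h1.pow (p + 1)).inv (by positivity)

theorem contDiffOn_log_norm : ContDiffOn ℝ ∞ (fun x : E => Real.log ‖x‖) {0}ᶜ := by
  intro x hx
  have hx0 : x ≠ 0 := hx
  exact ((contDiffAt_norm ℝ hx0).log (norm_ne_zero_iff.2 hx0)).contDiffWithinAt

theorem norm_iteratedFDeriv_comp_const_smul_le {f : E → ℝ} (hf : ContDiffOn ℝ ∞ f {0}ᶜ) {c : ℝ}
    (hc : c ≠ 0) {x : E} (hx : x ≠ 0) (k : ℕ) :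
    ‖iteratedFDeriv ℝ k (fun y => f (c • y)) x‖ ≤ |c| ^ k * ‖iteratedFDeriv ℝ k f (c • x)‖ := by
  have hU : IsOpen ({0}ᶜ : Set E) := isOpen_compl_singleton
  set g : E →L[ℝ] E := c • ContinuousLinearMap.id ℝ E
  have hpre : g ⁻¹' {0}ᶜ = {0}ᶜ := by
    ext y
    simp [g, hc]
  have hgx : g x ∈ ({0}ᶜ : Set E) := by simp [g, hc, hx]
  have h := g.iteratedFDerivWithin_comp_right (x := x) hf hU.uniqueDiffOn
    (by rw [hpre]; exact hU.uniqueDiffOn) hgx (i := k) (by exact_mod_cast le_top)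
  rw [hpre, iteratedFDerivWithin_of_isOpen k hU (by simpa using hx),
    iteratedFDerivWithin_of_isOpen k hU hgx] at h
  change ‖iteratedFDeriv ℝ k (f ∘ g) x‖ ≤ _
  rw [h, mul_comm]
  refine (ContinuousMultilinearMap.norm_compContinuousLinearMap_le _ _).trans ?_
  rw [Finset.prod_const, Finset.card_univ, Fintype.card_fin]
  have hg : ‖g‖ ≤ |c| := by
    refine (norm_smul_le c (ContinuousLinearMap.id ℝ E)).trans ?_
    rw [Real.norm_eq_abs]
    exact mul_le_of_le_one_right (abs_nonneg c) ContinuousLinearMap.norm_id_le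
  have : g x = c • x := by simp [g]
  rw [this]
  gcongr

/-- The Leibniz formula bounds the derivatives of a product by any weight `W` that dominates its
individual terms. -/
theorem exists_bound_mul {b f : E → ℝ} (hb : ContDiff ℝ ∞ b) (hf : ContDiffOn ℝ ∞ f {0}ᶜ)
    (r : ℝ) (k : ℕ) (W : E → ℝ)
    (h : ∀ i ≤ k, ∃ C, ∀ x : E, x ≠ 0 → ‖x‖ < r →
      ‖iteratedFDeriv ℝ i b x‖ * ‖iteratedFDeriv ℝ (k - i) f x‖ ≤ C * W x) :
    ∃ C, ∀ x : E, x ≠ 0 → ‖x‖ < r →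
      ‖iteratedFDeriv ℝ k (fun y => b y * f y) x‖ ≤ C * W x := by
  choose! C hC using h
  refine ⟨∑ i ∈ Finset.range (k + 1), (k.choose i : ℝ) * C i, fun x hx hxr => ?_⟩
  have hU : IsOpen ({0}ᶜ : Set E) := isOpen_compl_singleton
  have hxU : x ∈ ({0}ᶜ : Set E) := hx
  have hL := norm_iteratedFDerivWithin_mul_le hb.contDiffOn hf hU.uniqueDiffOn hxU (n := k)
    (by exact_mod_cast le_top)
  simp only [iteratedFDerivWithin_of_isOpen _ hU hxU] at hL
  refine hL.trans ?_
  rw [Finset.sum_mul]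
  refine Finset.sum_le_sum fun i hi => ?_
  rw [mul_assoc, mul_assoc]
  refine mul_le_mul_of_nonneg_left ?_ (Nat.cast_nonneg _)
  exact hC i (Nat.lt_succ_iff.1 (Finset.mem_range.1 hi)) x hx hxr

variable [ProperSpace E]

/-- If the `k`-th derivative of `f` at `x` is controlled by that at `x / ‖x‖` with a factor
`‖x‖ ^ m`, compactness of the unit sphere gives a bound on the punctured space. -/
theorem exists_bound_of_scaling {f : E → ℝ} (hf : ContDiffOn ℝ ∞ f {0}ᶜ) (k : ℕ) (m : ℤ)
    (h : ∀ x : E, x ≠ 0 → ‖iteratedFDeriv ℝ k f x‖ ≤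
      ‖x‖ ^ m * ‖iteratedFDeriv ℝ k f (‖x‖⁻¹ • x)‖) :
    ∃ C, ∀ x : E, x ≠ 0 → ‖iteratedFDeriv ℝ k f x‖ ≤ C * ‖x‖ ^ m := by
  have hcont : ContinuousOn (iteratedFDeriv ℝ k f) (Metric.sphere 0 1) :=
    (ContinuousOn.continuousOn_iteratedFDeriv hf isOpen_compl_singleton
      (by exact_mod_cast le_top)).mono fun x hx => by
        simp only [Set.mem_compl_iff, Set.mem_singleton_iff]
        rintro rfl
        simp at hx
  obtain ⟨C, hC⟩ := (isCompact_sphere (0 : E) 1).exists_bound_of_continuousOn hcont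
  refine ⟨C, fun x hx => (h x hx).trans ?_⟩
  have hxn : ‖x‖ ≠ 0 := norm_ne_zero_iff.2 hx
  have := hC (‖x‖⁻¹ • x) (by simp [norm_smul, hxn])
  rw [mul_comm]
  gcongr

theorem exists_bound_norm_zpow (p : ℤ) (k : ℕ) :
    ∃ C, ∀ x : E, x ≠ 0 → ‖iteratedFDeriv ℝ k (fun x : E => ‖x‖ ^ p) x‖ ≤
      C * ‖x‖ ^ (p - (k : ℤ)) := by
  refine exists_bound_of_scaling (contDiffOn_norm_zpow p) k _ fun x hx => ?_
  have hxn : 0 < ‖x‖ := norm_pos_iff.2 hx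
  have heq : (fun y : E => ‖y‖ ^ p) = fun y => ‖x‖ ^ p • ‖‖x‖⁻¹ • y‖ ^ p := by
    funext y
    rw [norm_smul, norm_inv, norm_norm, smul_eq_mul, mul_zpow, ← mul_assoc, ← mul_zpow,
      mul_inv_cancel₀ hxn.ne', one_zpow, one_mul]
  have hd : ContDiffAt ℝ k (fun y : E => ‖‖x‖⁻¹ • y‖ ^ p) x := by
    have h1 : ContDiffAt ℝ ∞ (fun y : E => ‖y‖ ^ p) (‖x‖⁻¹ • x) :=
      (contDiffOn_norm_zpow p _ (by simp [hx])).contDiffAt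
        (isOpen_compl_singleton.mem_nhds (by simp [hx]))
    exact (h1.comp x (contDiffAt_id.const_smul ‖x‖⁻¹)).of_le (by exact_mod_cast le_top)
  have h2 := norm_iteratedFDeriv_comp_const_smul_le (contDiffOn_norm_zpow (E := E) p)
    (inv_ne_zero hxn.ne') hx k
  conv_lhs => rw [heq]
  rw [iteratedFDeriv_const_smul_apply' hd, norm_smul, Real.norm_of_nonneg (by positivity)]
  rw [abs_of_pos (inv_pos.2 hxn)] at h2
  refine (mul_le_mul_of_nonneg_left h2 (by positivity)).trans_eq ?_
  rw [zpow_sub₀ hxn.ne', zpow_natCast, inv_pow]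
  ring

theorem exists_bound_log_norm (c : ℝ) {k : ℕ} (hk : k ≠ 0) :
    ∃ C, ∀ x : E, x ≠ 0 → ‖iteratedFDeriv ℝ k (fun x : E => Real.log ‖x‖ - c) x‖ ≤
      C * ‖x‖ ^ (-(k : ℤ)) := by
  have hf : ContDiffOn ℝ ∞ (fun x : E => Real.log ‖x‖ - c) {0}ᶜ :=
    contDiffOn_log_norm.sub contDiffOn_const
  refine exists_bound_of_scaling hf k _ fun x hx => ?_
  have hxn : 0 < ‖x‖ := norm_pos_iff.2 hx
  have hU : ({0}ᶜ : Set E) ∈ nhds x := isOpen_compl_singleton.mem_nhds hx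
  have heq : (fun y : E => Real.log ‖y‖ - c) =ᶠ[nhds x]
      fun y => (Real.log ‖‖x‖⁻¹ • y‖ - c) + Real.log ‖x‖ := by
    filter_upwards [hU] with y hy
    have hy0 : ‖y‖ ≠ 0 := norm_ne_zero_iff.2 hy
    rw [norm_smul, norm_inv, norm_norm, Real.log_mul (inv_ne_zero hxn.ne') hy0, Real.log_inv]
    ring
  have hd : ContDiffAt ℝ k (fun y : E => Real.log ‖‖x‖⁻¹ • y‖ - c) x := by
    have h1 : ContDiffAt ℝ ∞ (fun y : E => Real.log ‖y‖ - c) (‖x‖⁻¹ • x) :=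
      (hf _ (by simp [hx])).contDiffAt (isOpen_compl_singleton.mem_nhds (by simp [hx]))
    exact (h1.comp x (contDiffAt_id.const_smul ‖x‖⁻¹)).of_le (by exact_mod_cast le_top)
  have h2 := norm_iteratedFDeriv_comp_const_smul_le hf (inv_ne_zero hxn.ne') hx k
  rw [(heq.iteratedFDeriv (𝕜 := ℝ) k).eq_of_nhds, fun_iteratedFDeriv_add_apply hd contDiffAt_const,
    iteratedFDeriv_const_of_ne hk, Pi.zero_apply, add_zero]
  rw [abs_of_pos (inv_pos.2 hxn)] at h2
  refine h2.trans_eq ?_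
  rw [zpow_neg, zpow_natCast, inv_pow]

/-! ### Products with smooth functions -/

theorem exists_bound_contDiff {b : E → ℝ} (hb : ContDiff ℝ ∞ b) (r : ℝ) (k : ℕ) :
    ∃ C, ∀ x : E, ‖x‖ < r → ‖iteratedFDeriv ℝ k b x‖ ≤ C := by
  obtain ⟨C, hC⟩ := (isCompact_closedBall (0 : E) r).exists_bound_of_continuousOn
    (hb.continuous_iteratedFDeriv (m := k) (by exact_mod_cast le_top)).continuousOn
  exact ⟨C, fun x hx => hC x (by simpa using hx.le)⟩

theorem exists_bound_mul_norm_zpow {b : E → ℝ} (hb : ContDiff ℝ ∞ b) (r : ℝ) (p : ℤ) (k : ℕ) :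
    ∃ C, ∀ x : E, x ≠ 0 → ‖x‖ < r →
      ‖iteratedFDeriv ℝ k (fun y => b y * ‖y‖ ^ p) x‖ ≤ C * ‖x‖ ^ (p - (k : ℤ)) := by
  refine exists_bound_mul hb (contDiffOn_norm_zpow p) r k _ fun i hi => ?_
  obtain ⟨C, hC⟩ := exists_bound_contDiff hb r i
  obtain ⟨D, hD⟩ := exists_bound_norm_zpow (E := E) p (k - i)
  refine ⟨C * (D * r ^ i), fun x hx hxr => ?_⟩
  have hxn : 0 < ‖x‖ := norm_pos_iff.2 hx
  have h1 := hC x hxr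
  have h2 := hD x hx
  have hC0 : 0 ≤ C := (norm_nonneg _).trans h1
  have hD0 : 0 ≤ D := nonneg_of_mul_nonneg_left ((norm_nonneg _).trans h2) (by positivity)
  have hz : ‖x‖ ^ (p - ((k - i : ℕ) : ℤ)) = ‖x‖ ^ i * ‖x‖ ^ (p - (k : ℤ)) := by
    rw [← zpow_natCast, ← zpow_add₀ hxn.ne']
    congr 1
    push_cast [hi]
    ring
  calc _ ≤ C * (D * ‖x‖ ^ (p - ((k - i : ℕ) : ℤ))) := by gcongr
    _ = C * (D * ‖x‖ ^ i) * ‖x‖ ^ (p - (k : ℤ)) := by rw [hz]; ring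
    _ ≤ _ := by gcongr

/-- The logarithm itself, which is not bounded by a constant, occurs in the Leibniz formula only
with the `k`-th derivative of the smooth factor; as `k ≥ 1`, the bound `|log ‖x‖| ≲ ‖x‖⁻¹` is
enough. -/
theorem exists_bound_mul_log_norm {b : E → ℝ} (hb : ContDiff ℝ ∞ b) {r : ℝ} (c : ℝ)
    {k : ℕ} (hk : k ≠ 0) :
    ∃ C, ∀ x : E, x ≠ 0 → ‖x‖ < r →
      ‖iteratedFDeriv ℝ k (fun y => b y * (Real.log ‖y‖ - c)) x‖ ≤ C * ‖x‖ ^ (-(k : ℤ)) := by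
  refine exists_bound_mul hb (contDiffOn_log_norm.sub contDiffOn_const) r k _ fun i hi => ?_
  obtain ⟨C, hC⟩ := exists_bound_contDiff hb r i
  rcases hi.lt_or_eq with hlt | rfl
  · obtain ⟨D, hD⟩ := exists_bound_log_norm (E := E) c (k := k - i) (by omega)
    refine ⟨C * (D * r ^ i), fun x hx hxr => ?_⟩
    have hxn : 0 < ‖x‖ := norm_pos_iff.2 hx
    have h1 := hC x hxr
    have h2 := hD x hx
    have hC0 : 0 ≤ C := (norm_nonneg _).trans h1
    have hD0 : 0 ≤ D := nonneg_of_mul_nonneg_left ((norm_nonneg _).trans h2) (by positivity)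
    have hz : ‖x‖ ^ (-((k - i : ℕ) : ℤ)) = ‖x‖ ^ i * ‖x‖ ^ (-(k : ℤ)) := by
      rw [← zpow_natCast, ← zpow_add₀ hxn.ne']
      congr 1
      push_cast [hi]
      ring
    calc _ ≤ C * (D * ‖x‖ ^ (-((k - i : ℕ) : ℤ))) := by gcongr
      _ = C * (D * ‖x‖ ^ i) * ‖x‖ ^ (-(k : ℤ)) := by rw [hz]; ring
      _ ≤ _ := by gcongr
  · refine ⟨C * ((r ^ 2 + 1 + |c| * r) * r ^ (i - 1)), fun x hx hxr => ?_⟩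
    have hxn : 0 < ‖x‖ := norm_pos_iff.2 hx
    have h1 := hC x hxr
    have hC0 : 0 ≤ C := (norm_nonneg _).trans h1
    rw [Nat.sub_self, norm_iteratedFDeriv_zero, Real.norm_eq_abs]
    have hr : 0 < r := hxn.trans hxr
    have hlog : |Real.log ‖x‖ - c| * ‖x‖ ≤ r ^ 2 + 1 + |c| * r := by
      have h3 : Real.log ‖x‖ ≤ ‖x‖ := Real.log_le_self hxn.le
      have h4 : -Real.log ‖x‖ ≤ ‖x‖⁻¹ := by
        rw [← Real.log_inv]
        exact Real.log_le_self (inv_pos.2 hxn).le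
      have h5 : |Real.log ‖x‖ - c| ≤ ‖x‖ + ‖x‖⁻¹ + |c| := by
        refine (abs_sub _ _).trans (add_le_add ?_ le_rfl)
        rw [abs_le]
        constructor <;> linarith [inv_pos.2 hxn]
      calc |Real.log ‖x‖ - c| * ‖x‖ ≤ (‖x‖ + ‖x‖⁻¹ + |c|) * ‖x‖ := by gcongr
        _ = ‖x‖ ^ 2 + 1 + |c| * ‖x‖ := by field_simp
        _ ≤ _ := by gcongr
    calc _ ≤ C * |Real.log ‖x‖ - c| := by gcongr
      _ = C * ((|Real.log ‖x‖ - c| * ‖x‖) * ‖x‖ ^ (i - 1)) * ‖x‖ ^ (-(i : ℤ)) := by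
        obtain ⟨j, rfl⟩ := Nat.exists_eq_succ_of_ne_zero hk
        rw [zpow_neg, zpow_natCast, Nat.succ_sub_one, Nat.succ_eq_add_one, pow_succ]
        field_simp
      _ ≤ _ := by gcongr

end Homogeneous

/-! ### The radial profile of the difference -/

/-- In terms of `g(u) = P(u) + Q(u) log u` the difference is `κ |x|^(2-N) (g(0) - g(|x|²/4))`:
subtracting `Λ` removes exactly the value of the expansion at the origin. -/
theorem helmholtzPsi_sub_laplaceLambda {N : ℕ} (hN : 3 ≤ N) {ν : ℝ} (hν : ν = ((N : ℝ) - 2) / 2)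
    {p q : ℕ → ℝ} (h : IsNeumannExpansion ν p q) (hp0 : p 0 = -(Real.Gamma ν / Real.pi))
    {x : EuclideanSpace ℝ (Fin N)} (hx : x ≠ 0) :
    helmholtzPsi N x - laplaceLambda N x = 1 / 4 * Real.pi ^ (-ν) * ‖x‖ ^ (2 - (N : ℤ)) *
      (p 0 - logSum p q ((‖x‖ / 2) ^ 2)) := by
  have ht : 0 < ‖x‖ := norm_pos_iff.2 hx
  have hpi := Real.pi_pos
  have hN' : (3 : ℝ) ≤ N := by exact_mod_cast hN
  have hν0 : 0 < ν := by rw [hν]; linarith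
  have hpow : (2 * Real.pi * ‖x‖) ^ ((2 - (N : ℝ)) / 2) * (‖x‖ / 2) ^ (-ν) =
      Real.pi ^ (-ν) * ‖x‖ ^ (2 - (N : ℤ)) := by
    rw [show (2 - (N : ℝ)) / 2 = -ν by rw [hν]; ring,
      ← Real.mul_rpow (by positivity) (by positivity),
      show 2 * Real.pi * ‖x‖ * (‖x‖ / 2) = Real.pi * (‖x‖ * ‖x‖) by ring,
      Real.mul_rpow (by positivity) (by positivity), Real.mul_rpow ht.le ht.le,
      ← Real.rpow_add ht, ← Real.rpow_intCast]
    congr 2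
    rw [hν]
    push_cast
    ring
  have hΨ : helmholtzPsi N x = -(1 / 4) * (Real.pi ^ (-ν) * ‖x‖ ^ (2 - (N : ℤ))) *
      logSum p q ((‖x‖ / 2) ^ 2) := by
    rw [helmholtzPsi_eq, ← hν, h.besselY_eq _ ht, ← hpow, logSum]
    ring
  have hΛ : laplaceLambda N x = 1 / 4 * Real.pi ^ (-ν) * (Real.Gamma ν / Real.pi) *
      ‖x‖ ^ (2 - (N : ℤ)) := by
    rw [laplaceLambda, unitBallVolume]
    congr 1
    have hN2 : (N : ℝ) = 2 * ν + 2 := by rw [hν]; ring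
    have hG : Real.Gamma ν ≠ 0 := (Real.Gamma_pos_of_pos hν0).ne'
    rw [show (N : ℝ) / 2 = ν + 1 by rw [hν]; ring, Real.Gamma_add_one hν0.ne',
      Real.rpow_add hpi, Real.rpow_one, Real.rpow_neg hpi.le, hN2]
    have : 2 * ν + 2 ≠ 0 := by positivity
    have : Real.pi ^ ν ≠ 0 := by positivity
    rw [show 2 * ν + 2 - 2 = 2 * ν by ring]
    field_simp
    ring
  rw [hΨ, hΛ, hp0]
  ring

/-- Extracting the leading powers: `P - P(0)` is divisible by `u = (t/2)²`, and `Q` by `uⁿ`. -/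
theorem profile_eq {N n : ℕ} {p q : ℕ → ℝ} (hp : EntireCoeff p) (hq : EntireCoeff q)
    (hqn : ∀ k < n, q k = 0) (hNn : N = 2 * n + 2 ∨ q = fun _ => 0) (κ : ℝ) {t : ℝ} (ht : 0 < t) :
    κ * t ^ (2 - (N : ℤ)) * (p 0 - logSum p q ((t / 2) ^ 2)) =
      -(κ / 4) * powerSum (fun k => p (k + 1)) (t ^ 2 / 4) * t ^ (4 - (N : ℤ)) +
      -(2 * κ / 4 ^ n) * powerSum (fun k => q (k + n)) (t ^ 2 / 4) *
        (Real.log t - Real.log 2) := by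
  have hu : (t / 2) ^ 2 = t ^ 2 / 4 := by ring
  have h4 : t ^ (4 - (N : ℤ)) = t ^ (2 - (N : ℤ)) * t ^ 2 := by
    rw [← zpow_natCast, ← zpow_add₀ ht.ne']
    congr 1
    push_cast
    ring
  have hlog : Real.log ((t / 2) ^ 2) = 2 * (Real.log t - Real.log 2) := by
    rw [Real.log_pow, Real.log_div ht.ne' two_ne_zero]
    push_cast
    ring
  have hQ : t ^ (2 - (N : ℤ)) * powerSum q ((t / 2) ^ 2) =
      powerSum (fun k => q (k + n)) (t ^ 2 / 4) / 4 ^ n := by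
    rcases hNn with rfl | rfl
    · have h2 : t ^ (2 - ((2 * n + 2 : ℕ) : ℤ)) = ((t ^ 2) ^ n)⁻¹ := by
        rw [← pow_mul, ← zpow_natCast, ← zpow_neg]
        congr 1
        push_cast
        ring
      rw [powerSum_eq_pow_mul hqn _ hq, h2, hu, div_pow]
      field_simp
    · simp [powerSum]
  have hP := hp.powerSum_eq_add ((t / 2) ^ 2)
  have h5 : t ^ (2 - (N : ℤ)) * (p 0 - logSum p q ((t / 2) ^ 2)) =
      -(t ^ (2 - (N : ℤ)) * t ^ 2 / 4 * powerSum (fun k => p (k + 1)) (t ^ 2 / 4)) -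
        (t ^ (2 - (N : ℤ)) * powerSum q ((t / 2) ^ 2)) * (2 * (Real.log t - Real.log 2)) := by
    rw [logSum, hlog, hP, hu]
    ring
  rw [mul_assoc, h5, hQ, h4]
  ring

theorem contDiff_powerSum_div_four {a : ℕ → ℝ} (ha : EntireCoeff a) (c : ℝ) :
    ContDiff ℝ ∞ fun s : ℝ => c * powerSum a (s / 4) :=
  contDiff_const.mul (ha.contDiff_powerSum.comp (contDiff_id.div_const 4))

/-- `Y_{1/2}(t) = -√(2 / (π t)) cos t`. -/
theorem logSum_halfCoeff_zero (t : ℝ) :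
    logSum (halfCoeff 0) (fun _ => 0) ((t / 2) ^ 2) = -(Real.cos t / √Real.pi) := by
  have hG : ∀ k : ℕ, (k.factorial : ℝ) * Real.Gamma ((k : ℝ) + 1 / 2) * 4 ^ k =
      ((2 * k).factorial : ℝ) * √Real.pi := by
    intro k
    induction k with
    | zero => simpa using Real.Gamma_one_half_eq
    | succ k ih =>
      have hk : (k : ℝ) + 1 / 2 ≠ 0 := by positivity
      rw [show 2 * (k + 1) = 2 * k + 1 + 1 by ring, Nat.factorial_succ, Nat.factorial_succ,
        Nat.factorial_succ]
      push_cast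
      rw [show (k : ℝ) + 1 + 1 / 2 = (k + 1 / 2) + 1 by ring, Real.Gamma_add_one hk]
      calc _ = 4 * ((k : ℝ) + 1) * (k + 1 / 2) *
            ((k.factorial : ℝ) * Real.Gamma ((k : ℝ) + 1 / 2) * 4 ^ k) := by ring
        _ = _ := by rw [ih]; ring
  have hz : powerSum (fun _ => 0) ((t / 2) ^ 2) = 0 := by simp [powerSum]
  rw [logSum, hz, zero_mul, add_zero, Real.cos_eq_tsum, ← tsum_div_const, ← tsum_neg, powerSum]
  refine tsum_congr fun k => ?_
  have hpi : 0 < √Real.pi := Real.sqrt_pos.2 Real.pi_pos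
  have hGk : 0 < Real.Gamma ((k : ℝ) + 1 / 2) := Real.Gamma_pos_of_pos (by positivity)
  have hk := hG k
  rw [halfCoeff, Nat.cast_zero, sub_zero, zero_add, div_pow, div_pow, ← pow_mul,
    show (2 : ℝ) ^ 2 = 4 by norm_num, neg_mul, div_mul_div_comm, hk, div_div]

/-- The difference as a radial function `a(t²) t^(4-N) + b(t²) log(t/2)` with smooth `a`, `b`, the
sign of this function on `(0, r]`, and the sign of its leading coefficient at the origin. -/
theorem exists_profile (N : ℕ) (hN : 3 ≤ N) (r : ℝ)
    (hr4 : 4 ≤ N → r < besselYFirstZero (((N : ℝ) - 4) / 2)) (hr3 : N = 3 → r < Real.pi) :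
    ∃ a b : ℝ → ℝ, ContDiff ℝ ∞ a ∧ ContDiff ℝ ∞ b ∧
      (∀ x : EuclideanSpace ℝ (Fin N), x ≠ 0 → helmholtzPsi N x - laplaceLambda N x =
        a (‖x‖ ^ 2) * ‖x‖ ^ (4 - (N : ℤ)) + b (‖x‖ ^ 2) * (Real.log ‖x‖ - Real.log 2)) ∧
      (4 ≤ N → ∀ t, 0 < t → t ≤ r →
        0 < a (t ^ 2) * t ^ (4 - (N : ℤ)) + b (t ^ 2) * (Real.log t - Real.log 2)) ∧
      (N = 3 → b = 0 ∧ ∀ t, 0 ≤ t → t ≤ r → a (t ^ 2) < 0) ∧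
      (N = 4 → b 0 < 0) ∧ (5 ≤ N → 0 < a 0) := by
  rcases Nat.even_or_odd' N with ⟨n, rfl | rfl⟩
  -- Even dimension `2n + 4`: integer order `n + 1`, with a logarithm.
  · obtain ⟨n, rfl⟩ := Nat.exists_eq_add_of_le' (show 2 ≤ n by omega)
    have hexp := isNeumannExpansion_nat (n + 1)
    have hexp' := isNeumannExpansion_nat n
    have hlad := isLadder_neumannCoeff n
    have hν : ((n + 1 : ℕ) : ℝ) = (((2 * (n + 2) : ℕ) : ℝ) - 2) / 2 := by push_cast; ring
    have hν' : (((2 * (n + 2) : ℕ) : ℝ) - 4) / 2 = n := by push_cast; ring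
    rw [hν'] at hr4
    set κ : ℝ := 1 / 4 * Real.pi ^ (-((n + 1 : ℕ) : ℝ)) with hκ
    have hκ0 : 0 < κ := by have := Real.pi_pos; positivity
    have hid := fun {t : ℝ} (ht : 0 < t) => profile_eq (N := 2 * (n + 2)) (n := n + 1)
      hexp.entire_left hexp.entire_right (fun k hk => by simp [neumannLogCoeff, hk])
      (.inl (by ring)) κ ht
    refine ⟨_, _, contDiff_powerSum_div_four hexp.entire_left.shift (-(κ / 4)),
      contDiff_powerSum_div_four (hexp.entire_right.shift_iterate (n + 1))
        (-(2 * κ / 4 ^ (n + 1))), fun x hx => ?_, fun _ t ht htr => ?_, fun h => by omega,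
      fun h => ?_, fun h => ?_⟩
    · rw [helmholtzPsi_sub_laplaceLambda hN hν hexp (neumannCoeff_zero n.succ_pos) hx,
        ← hid (norm_pos_iff.2 hx)]
    · rw [← hid ht]
      have hneg : 0 < neumannLogCoeff n 0 ∨ neumannLogCoeff n 0 = 0 ∧ neumannCoeff n 0 < 0 := by
        rcases Nat.eq_zero_or_pos n with rfl | hn
        · left
          simp [neumannLogCoeff, Real.pi_pos]
        · right
          refine ⟨by simp [neumannLogCoeff, hn], ?_⟩
          rw [neumannCoeff_zero hn, neg_lt_zero]
          exact div_pos (Real.Gamma_pos_of_pos (by positivity)) Real.pi_pos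
      exact mul_pos (by positivity) (sub_pos.2 (logSum_lt_of_lt_besselYFirstZero hexp.entire_left
        hexp.entire_right hlad hexp' hneg ht (htr.trans_lt (hr4 (by omega)))))
    · have : 0 < neumannLogCoeff (n + 1) (0 + (n + 1)) := by
        rw [neumannLogCoeff_add]
        have := Real.pi_pos
        positivity
      rw [zero_div, powerSum_zero, neg_mul, neg_lt_zero]
      positivity
    · rw [zero_div, powerSum_zero, zero_add]
      have hn : 0 < n := by omega
      -- The coefficient of `u` at order `n + 1` is the constant coefficient `-Γ(n)/π` at order `n`.
      have h1 : neumannCoeff (n + 1) 1 < 0 := by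
        have h2 := hlad.left 0
        rw [neumannCoeff_zero hn, zero_add, neumannLogCoeff, if_pos (by omega)] at h2
        have : 0 < Real.Gamma n / Real.pi :=
          div_pos (Real.Gamma_pos_of_pos (by positivity)) Real.pi_pos
        simp only [Nat.cast_zero, zero_add, one_mul, add_zero] at h2
        linarith
      nlinarith
  · rcases Nat.eq_zero_or_pos (n - 1) with hn1 | hn1
    -- Dimension three: the expansion is a cosine, and the sign comes from `cos t < 1`.
    · obtain rfl : n = 1 := by omega
      have hexp := isNeumannExpansion_half 0
      have hν : (((0 : ℕ) : ℝ) + 1 / 2) = (((2 * 1 + 1 : ℕ) : ℝ) - 2) / 2 := by push_cast; ring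
      set κ : ℝ := 1 / 4 * Real.pi ^ (-(((0 : ℕ) : ℝ) + 1 / 2)) with hκ
      have hκ0 : 0 < κ := by have := Real.pi_pos; positivity
      have hid := fun {t : ℝ} (ht : 0 < t) => profile_eq (N := 2 * 1 + 1) (n := 0)
        hexp.entire_left hexp.entire_right (fun k hk => rfl) (.inr rfl) κ ht
      have hb : (fun s : ℝ => -(2 * κ / 4 ^ 0) * powerSum (fun _ => 0) (s / 4)) = 0 := by
        funext s
        simp [powerSum]
      refine ⟨_, _, contDiff_powerSum_div_four hexp.entire_left.shift (-(κ / 4)),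
        contDiff_powerSum_div_four (hexp.entire_right.shift_iterate 0)
          (-(2 * κ / 4 ^ 0)), fun x hx => ?_, fun h => by omega, fun _ => ⟨hb, fun t ht htr => ?_⟩,
        fun h => by omega, fun h => by omega⟩
      · rw [helmholtzPsi_sub_laplaceLambda hN hν hexp (halfCoeff_zero 0) hx,
          ← hid (norm_pos_iff.2 hx)]
      · rcases ht.eq_or_lt with rfl | ht
        · have h1 : 0 < halfCoeff 0 1 := by
            have : 0 < Real.Gamma (1 + 1 / 2) := Real.Gamma_pos_of_pos (by norm_num)
            simp only [halfCoeff, Nat.cast_zero, sub_zero, Nat.cast_one, zero_add, pow_one,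
              Nat.factorial_one, one_mul]
            rw [neg_div, neg_neg]
            positivity
          rw [zero_pow two_ne_zero, zero_div, powerSum_zero, zero_add, neg_mul, neg_lt_zero]
          positivity
        · have h0 : halfCoeff 0 0 = -(1 / √Real.pi) := by
            have := logSum_halfCoeff_zero 0
            rwa [zero_div, zero_pow two_ne_zero, logSum, powerSum_zero, powerSum_zero, zero_mul,
              add_zero, Real.cos_zero] at this
          have h1 := hid ht
          rw [logSum_halfCoeff_zero, congrFun hb (t ^ 2), h0] at h1
          have hpi : 0 < √Real.pi := Real.sqrt_pos.2 Real.pi_pos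
          have hcos : Real.cos t < 1 := by
            have := Real.strictAntiOn_cos ⟨le_rfl, Real.pi_pos.le⟩
              ⟨ht.le, htr.trans (hr3 rfl).le⟩ ht
            rwa [Real.cos_zero] at this
          have h2 : κ * t ^ (2 - ((2 * 1 + 1 : ℕ) : ℤ)) *
              (-(1 / √Real.pi) - -(Real.cos t / √Real.pi)) < 0 := by
            refine mul_neg_of_pos_of_neg (by positivity) ?_
            rw [neg_sub_neg, sub_neg]
            gcongr
          rw [h1] at h2
          simp only [Pi.zero_apply, zero_mul, add_zero] at h2
          exact neg_of_mul_neg_left h2 (by positivity)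
    -- Odd dimension `2m + 5`: half-integer order `m + 3/2`, without logarithm.
    · obtain ⟨m, rfl⟩ := Nat.exists_eq_add_of_le' (show 2 ≤ n by omega)
      have hexp := isNeumannExpansion_half (m + 1)
      have hexp' := isNeumannExpansion_half m
      have hlad := isLadder_halfCoeff m
      have hν : (((m + 1 : ℕ) : ℝ) + 1 / 2) = (((2 * (m + 2) + 1 : ℕ) : ℝ) - 2) / 2 := by
        push_cast; ring
      have hν' : (((2 * (m + 2) + 1 : ℕ) : ℝ) - 4) / 2 = m + 1 / 2 := by push_cast; ring
      rw [hν'] at hr4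
      set κ : ℝ := 1 / 4 * Real.pi ^ (-(((m + 1 : ℕ) : ℝ) + 1 / 2)) with hκ
      have hκ0 : 0 < κ := by have := Real.pi_pos; positivity
      have hid := fun {t : ℝ} (ht : 0 < t) => profile_eq (N := 2 * (m + 2) + 1) (n := 0)
        hexp.entire_left hexp.entire_right (fun k hk => rfl) (.inr rfl) κ ht
      have h0 : halfCoeff m 0 < 0 := by
        rw [halfCoeff_zero, neg_lt_zero]
        exact div_pos (Real.Gamma_pos_of_pos (by positivity)) Real.pi_pos
      refine ⟨_, _, contDiff_powerSum_div_four hexp.entire_left.shift (-(κ / 4)),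
        contDiff_powerSum_div_four (hexp.entire_right.shift_iterate 0)
          (-(2 * κ / 4 ^ 0)), fun x hx => ?_, fun _ t ht htr => ?_, fun h => by omega,
        fun h => by omega, fun h => ?_⟩
      · rw [helmholtzPsi_sub_laplaceLambda hN hν hexp (halfCoeff_zero _) hx,
          ← hid (norm_pos_iff.2 hx)]
      · rw [← hid ht]
        exact mul_pos (by positivity) (sub_pos.2 (logSum_lt_of_lt_besselYFirstZero hexp.entire_left
          hexp.entire_right hlad hexp' (.inr ⟨rfl, h0⟩) ht (htr.trans_lt (hr4 (by omega)))))
      · have h2 := hlad.left 0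
        simp only [Nat.cast_zero, zero_add, one_mul, add_zero] at h2
        rw [zero_div, powerSum_zero, zero_add, h2]
        nlinarith

/-! ### The estimates -/

/-- A continuous positive function on `[0, r]` is bounded between two positive constants. It is
applied to the quotient of the profile by the expected rate, extended continuously to the
origin. -/
theorem exists_pos_bounds {K : ℝ → ℝ} {r : ℝ} (hr : 0 < r) (hK : ContinuousOn K (Set.Icc 0 r))
    (hpos : ∀ t ∈ Set.Icc 0 r, 0 < K t) :
    ∃ κ₁ κ₂ : ℝ, 0 < κ₁ ∧ 0 < κ₂ ∧ ∀ t ∈ Set.Icc 0 r, κ₁ ≤ K t ∧ K t ≤ κ₂ := by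
  have hne : (Set.Icc 0 r).Nonempty := ⟨0, le_rfl, hr.le⟩
  obtain ⟨s, hs, hmin⟩ := isCompact_Icc.exists_isMinOn hne hK
  obtain ⟨s', hs', hmax⟩ := isCompact_Icc.exists_isMaxOn hne hK
  exact ⟨K s, K s', hpos s hs, hpos s' hs', fun t ht => ⟨hmin ht, hmax ht⟩⟩

/-- With `1 / log 0 = 0`, the reciprocal of the logarithm is continuous on `[0, r]` for `r < 1`. -/
theorem continuousOn_inv_log {r : ℝ} (hr : r < 1) :
    ContinuousOn (fun t => (Real.log t)⁻¹) (Set.Icc 0 r) := by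
  intro t ht
  rcases ht.1.eq_or_lt with rfl | h0
  · have h := Real.tendsto_log_nhdsNE_zero.inv_tendsto_atBot
    refine ContinuousAt.continuousWithinAt ?_
    rw [continuousAt_iff_punctured_nhds, Real.log_zero, inv_zero]
    exact h
  · exact ((Real.continuousAt_log h0.ne').inv₀
      (Real.log_neg h0 (ht.2.trans_lt hr)).ne).continuousWithinAt

theorem helmholtzPsi_sub_laplaceLambda_bounds (N : ℕ) (hN : 3 ≤ N) (r : ℝ) (hr : 0 < r)
    (hr4 : 4 ≤ N → r < besselYFirstZero (((N : ℝ) - 4) / 2)) (hr3 : N = 3 → r < Real.pi) :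
    ∃ κ₁ κ₂ : ℝ, 0 < κ₁ ∧ 0 < κ₂ ∧
      ∀ x ∈ Metric.ball (0 : EuclideanSpace ℝ (Fin N)) r, x ≠ 0 →
        (5 ≤ N →
          κ₁ * ‖x‖ ^ (4 - (N : ℤ)) ≤ helmholtzPsi N x - laplaceLambda N x ∧
          helmholtzPsi N x - laplaceLambda N x ≤ κ₂ * ‖x‖ ^ (4 - (N : ℤ))) ∧
        (N = 4 →
          κ₁ * |Real.log ‖x‖| ≤ helmholtzPsi N x - laplaceLambda N x ∧
          helmholtzPsi N x - laplaceLambda N x ≤ κ₂ * |Real.log ‖x‖|) ∧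
        (N = 3 →
          -κ₂ * ‖x‖ ≤ helmholtzPsi N x - laplaceLambda N x ∧
          helmholtzPsi N x - laplaceLambda N x ≤ -κ₁ * ‖x‖) := by
  obtain ⟨a, b, ha, hb, hD, hpos, h3, h4, h5⟩ := exists_profile N hN r hr4 hr3
  have hac : Continuous fun t : ℝ => a (t ^ 2) := ha.continuous.comp (continuous_pow 2)
  have hbc : Continuous fun t : ℝ => b (t ^ 2) := hb.continuous.comp (continuous_pow 2)
  obtain rfl | rfl | hN5 : N = 3 ∨ N = 4 ∨ 5 ≤ N := by omega
  · obtain ⟨κ₁, κ₂, h₁, h₂, hκ⟩ := exists_pos_bounds hr hac.neg.continuousOn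
      (fun t ht => neg_pos.2 ((h3 rfl).2 t ht.1 ht.2))
    refine ⟨κ₁, κ₂, h₁, h₂, fun x hx hx0 => ⟨fun h => by omega, fun h => by omega, fun _ => ?_⟩⟩
    have hxr : ‖x‖ < r := by simpa using hx
    obtain ⟨hl, hu⟩ := hκ ‖x‖ ⟨norm_nonneg x, hxr.le⟩
    simp only [Pi.neg_apply] at hl hu
    have hx1 : ‖x‖ ^ (4 - ((3 : ℕ) : ℤ)) = ‖x‖ := by norm_num
    rw [hD x hx0, (h3 rfl).1, Pi.zero_apply, zero_mul, add_zero, hx1]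
    constructor <;> gcongr <;> linarith
  · have hr1 : r < 1 := by
      have h := hr4 le_rfl
      norm_num at h
      exact h.trans_le besselYFirstZero_zero_le_one
    -- The quotient by `|log t|` is positive at the origin, with value `-b 0`, as `1 / log 0 = 0`.
    have key : ∀ t, 0 < t → t ≤ r →
        a (t ^ 2) * t ^ (4 - ((4 : ℕ) : ℤ)) + b (t ^ 2) * (Real.log t - Real.log 2) =
        (-(a (t ^ 2) - b (t ^ 2) * Real.log 2) * (Real.log t)⁻¹ - b (t ^ 2)) *
          |Real.log t| := by
      intro t ht htr
      have hlog : Real.log t < 0 := Real.log_neg ht (htr.trans_lt hr1)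
      have hlog0 := hlog.ne
      rw [abs_of_neg hlog]
      norm_num
      field_simp
      ring
    obtain ⟨κ₁, κ₂, h₁, h₂, hκ⟩ := exists_pos_bounds hr
      (((hac.sub (hbc.mul_const (Real.log 2))).neg.continuousOn.mul
        (continuousOn_inv_log hr1)).sub hbc.continuousOn) (fun t ht => by
        rcases ht.1.eq_or_lt with rfl | ht0
        · simpa using h4 rfl
        · have h := hpos le_rfl t ht0 ht.2
          rw [key t ht0 ht.2] at h
          exact pos_of_mul_pos_left h (abs_nonneg _))
    refine ⟨κ₁, κ₂, h₁, h₂, fun x hx hx0 => ⟨fun h => by omega, fun _ => ?_, fun h => by omega⟩⟩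
    have hxr : ‖x‖ < r := by simpa using hx
    obtain ⟨hl, hu⟩ := hκ ‖x‖ ⟨norm_nonneg x, hxr.le⟩
    rw [hD x hx0, key ‖x‖ (norm_pos_iff.2 hx0) hxr.le]
    constructor <;> gcongr
    · exact hl
    · exact hu
  -- The quotient by `t ^ (4 - N)`, in which the logarithm occurs as the continuous `t log t`.
  · have key : ∀ t, 0 < t →
        a (t ^ 2) * t ^ (4 - (N : ℤ)) + b (t ^ 2) * (Real.log t - Real.log 2) =
        (a (t ^ 2) + t ^ (N - 5) * (b (t ^ 2) * (t * Real.log t - t * Real.log 2))) *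
          t ^ (4 - (N : ℤ)) := by
      intro t ht
      have hz : t ^ (N - 5) * t * t ^ (4 - (N : ℤ)) = 1 := by
        rw [← pow_succ, ← zpow_natCast, ← zpow_add₀ ht.ne',
          show ((N - 5 + 1 : ℕ) : ℤ) + (4 - (N : ℤ)) = 0 by omega, zpow_zero]
      linear_combination -(b (t ^ 2) * (Real.log t - Real.log 2)) * hz
    obtain ⟨κ₁, κ₂, h₁, h₂, hκ⟩ := exists_pos_bounds hr
      (hac.add ((continuous_pow (N - 5)).mul (hbc.mul (Real.continuous_mul_log.sub
        (continuous_id.mul_const (Real.log 2)))))).continuousOn (fun t ht => by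
        rcases ht.1.eq_or_lt with rfl | ht0
        · simpa using h5 hN5
        · have h := hpos (by omega) t ht0 ht.2
          rw [key t ht0] at h
          exact pos_of_mul_pos_left h (by positivity))
    refine ⟨κ₁, κ₂, h₁, h₂, fun x hx hx0 => ⟨fun _ => ?_, fun h => by omega, fun h => by omega⟩⟩
    have hxr : ‖x‖ < r := by simpa using hx
    obtain ⟨hl, hu⟩ := hκ ‖x‖ ⟨norm_nonneg x, hxr.le⟩
    rw [hD x hx0, key ‖x‖ (norm_pos_iff.2 hx0)]
    constructor <;> gcongr
    · exact hl
    · exact hu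

theorem mainTheorem2 (N : ℕ) (hN : 3 ≤ N) (r : ℝ) (hr : 0 < r)
    (hr4 : 4 ≤ N → r < besselYFirstZero (((N : ℝ) - 4) / 2))
    (hr3 : N = 3 → r < Real.pi) :
    (∃ κ₁ κ₂ : ℝ, 0 < κ₁ ∧ 0 < κ₂ ∧
      ∀ x ∈ Metric.ball (0 : EuclideanSpace ℝ (Fin N)) r, x ≠ 0 →
        (5 ≤ N →
          κ₁ * ‖x‖ ^ (4 - (N : ℤ)) ≤ helmholtzPsi N x - laplaceLambda N x ∧
          helmholtzPsi N x - laplaceLambda N x ≤ κ₂ * ‖x‖ ^ (4 - (N : ℤ))) ∧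
        (N = 4 →
          κ₁ * |Real.log ‖x‖| ≤ helmholtzPsi N x - laplaceLambda N x ∧
          helmholtzPsi N x - laplaceLambda N x ≤ κ₂ * |Real.log ‖x‖|) ∧
        (N = 3 →
          -κ₂ * ‖x‖ ≤ helmholtzPsi N x - laplaceLambda N x ∧
          helmholtzPsi N x - laplaceLambda N x ≤ -κ₁ * ‖x‖)) ∧
    ContDiffOn ℝ ∞ (fun y : EuclideanSpace ℝ (Fin N) => helmholtzPsi N y - laplaceLambda N y)
      (Metric.ball 0 r \ {0}) ∧
    (∀ k : ℕ, 1 ≤ k → ∃ κ₃ : ℝ, 0 < κ₃ ∧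
      ∀ α : Fin N → ℕ, ∑ i, α i = k →
        ∀ x ∈ Metric.ball (0 : EuclideanSpace ℝ (Fin N)) r, x ≠ 0 →
          |multiDeriv α (fun y => helmholtzPsi N y - laplaceLambda N y) x| ≤
            κ₃ * ‖x‖ ^ (4 - (N : ℤ) - (k : ℤ))) := by
  refine ⟨helmholtzPsi_sub_laplaceLambda_bounds N hN r hr hr4 hr3, ?_⟩
  obtain ⟨a, b, ha, hb, hD, -, h3, -, -⟩ := exists_profile N hN r hr4 hr3
  have hA : ContDiff ℝ ∞ fun x : EuclideanSpace ℝ (Fin N) => a (‖x‖ ^ 2) :=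
    ha.comp (contDiff_norm_sq ℝ)
  have hB : ContDiff ℝ ∞ fun x : EuclideanSpace ℝ (Fin N) => b (‖x‖ ^ 2) :=
    hb.comp (contDiff_norm_sq ℝ)
  have hU : IsOpen ({0}ᶜ : Set (EuclideanSpace ℝ (Fin N))) := isOpen_compl_singleton
  have hf₁ : ContDiffOn ℝ ∞ (fun x : EuclideanSpace ℝ (Fin N) =>
      a (‖x‖ ^ 2) * ‖x‖ ^ (4 - (N : ℤ))) {0}ᶜ := hA.contDiffOn.mul (contDiffOn_norm_zpow _)
  have hf₂ : ContDiffOn ℝ ∞ (fun x : EuclideanSpace ℝ (Fin N) =>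
      b (‖x‖ ^ 2) * (Real.log ‖x‖ - Real.log 2)) {0}ᶜ :=
    hB.contDiffOn.mul (contDiffOn_log_norm.sub contDiffOn_const)
  have heq : Set.EqOn (fun y : EuclideanSpace ℝ (Fin N) => helmholtzPsi N y - laplaceLambda N y)
      (fun x => a (‖x‖ ^ 2) * ‖x‖ ^ (4 - (N : ℤ)) +
        b (‖x‖ ^ 2) * (Real.log ‖x‖ - Real.log 2)) {0}ᶜ := fun x hx => hD x hx
  have hsmooth := (hf₁.add hf₂).congr heq
  refine ⟨hsmooth.mono fun x hx => hx.2, fun k hk => ?_⟩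
  obtain ⟨C, hC⟩ := exists_bound_mul_norm_zpow hA r (4 - (N : ℤ)) k
  obtain ⟨D, hDb⟩ : ∃ D, ∀ x : EuclideanSpace ℝ (Fin N), x ≠ 0 → ‖x‖ < r →
      ‖iteratedFDeriv ℝ k (fun x : EuclideanSpace ℝ (Fin N) =>
        b (‖x‖ ^ 2) * (Real.log ‖x‖ - Real.log 2)) x‖ ≤ D * ‖x‖ ^ (4 - (N : ℤ) - (k : ℤ)) := by
    -- The logarithmic part is absent for `N = 3`; otherwise `4 - N ≤ 0`, and its bound
    -- `‖x‖ ^ (-k)` is at most a multiple of the claimed one.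
    rcases hN.eq_or_lt with hN3 | hN4
    · refine ⟨0, fun x _ _ => ?_⟩
      rw [(h3 hN3.symm).1]
      simp only [Pi.zero_apply, zero_mul]
      rw [iteratedFDeriv_const_of_ne (by omega)]
      simp
    · obtain ⟨D, hDb⟩ := exists_bound_mul_log_norm hB (r := r) (Real.log 2) (k := k) (by omega)
      refine ⟨|D| * r ^ (N - 4), fun x hx hxr => (hDb x hx hxr).trans ?_⟩
      have hxn : 0 < ‖x‖ := norm_pos_iff.2 hx
      have hz : ‖x‖ ^ (-(k : ℤ)) = ‖x‖ ^ (N - 4) * ‖x‖ ^ (4 - (N : ℤ) - (k : ℤ)) := by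
        rw [← zpow_natCast, ← zpow_add₀ hxn.ne']
        congr 1
        omega
      rw [hz, ← mul_assoc]
      gcongr
      exact le_abs_self D
  refine ⟨|C + D| + 1, by positivity, fun α hα x hx hx0 => ?_⟩
  have hxr : ‖x‖ < r := by simpa using hx
  have hxn : 0 < ‖x‖ := norm_pos_iff.2 hx0
  have h := abs_multiDeriv_le hU hsmooth α (x := x) hx0
  have hle : ((k : ℕ∞) : WithTop ℕ∞) ≤ ∞ := by exact_mod_cast le_top
  rw [hα, ((heq.eventuallyEq_of_mem (hU.mem_nhds hx0)).iteratedFDeriv (𝕜 := ℝ) k).eq_of_nhds,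
    fun_iteratedFDeriv_add_apply
      (((hf₁ x hx0).contDiffAt (hU.mem_nhds hx0)).of_le hle)
      (((hf₂ x hx0).contDiffAt (hU.mem_nhds hx0)).of_le hle)] at h
  refine h.trans ((norm_add_le _ _).trans ((add_le_add (hC x hx0 hxr) (hDb x hx0 hxr)).trans ?_))
  rw [← add_mul]
  refine mul_le_mul_of_nonneg_right ?_ (by positivity)
  linarith [le_abs_self (C + D)]

end
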